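/- **Setting.** Let $\Gamma=\{\xi\in\mathbb R^3:\xi_1^2+\xi_2^2=\xi_3^2,\ \tfrac12\le|\xi_3|\le1\}$ and let $N_{\delta}(\Gamma)$ be its closed $\delta$-neighbourhood. For $\xi=(\xi_1,\xi_2,1)$ with $\xi_1^2+\xi_2^2=1$ put $\mathbf c(\xi)=(\xi_1,\xi_2,1)$, $\mathbf n(\xi)=(\xi_1,\xi_2,-1)$, $\mathbf t(\xi)=(-\xi_2,\xi_1,0)$. For $0<s\le1$ the sector of aperture $d(\tau)=s$ and direction $\xi$ is the box $$\tau(s,\xi)=\{\omega:\ 1\le\mathbf c(\xi)\cdot\omega\le2,\ |\mathbf n(\xi)\cdot\omega|\le s^2,\ |\mathbf t(\xi)\cdot\omega|\le s\},$$ and $A\tau$ denotes its dilate by the factor $A$ about its centroid. For each $s$, $\mathbf S_s$ is the set of the sectors $\tau(s,\xi)$ for $\lceil10s^{-1}\rceil$ evenly spaced directions $\xi$ (in any position) on the circle. For $\tau=\tau(s,\xi)$ and $R\ge1$ let $$U_{\tau,R}=\{x:\ |\mathbf c(\xi)\cdot x|\le Rs^2,\ |\mathbf n(\xi)\cdot x|\le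 R,\ |\mathbf t(\xi)\cdot x|\le Rs\}.$$ For each $\tau$ fix any tiling of $\mathbb R^3$ (up to overlaps of measure zero) by translates $U$ of $U_{\tau,R}$, and let $\sum_{U\parallel U_{\tau,R}}$ denote the sum over its tiles. For each dyadic $s\in[R^{-1/2},1]$ fix any partition $\mathbf S_{R^{-1/2}}=\bigsqcup_{\tau\in\mathbf S_s}\mathcal A(\tau)$ such that every $\theta\in \mathcal A(\tau)$ intersects $\tau$. Given functions $f_\theta$, $\theta\in\mathbf S_{R^{-1/2}}$, and a tile $U$ of the tiling for $\tau$, set $S_Uf=\big(\sum_{\theta\in \mathcal A(\tau)}|f_\theta|^2\big)^{1/2}\big|_U$. **Lemma.** For every $A\ge1$ there is a constant $C$, depending only on $A$, with the following property. Let $R\ge1$, let $f:\mathbb R^3\to\mathbb C$ be a function that defines a tempered distribution and has $\operatorname{supp}\hat f\subset N_{R^{-1}}(\Gamma)$, and let $f=\sum_{\theta\in\mathbf S_{R^{-1/2}}}f_\theta$ almost everywhere, where each $f_\theta$ is a function that defines a tempered distribution and $\operatorname{supp}\hat f_\theta\subset A\theta$. Let $g=\sum_{\theta\in\mathbf S_{R^{-1/2}}}|f_\theta|^2$.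 Then, in $[0,\infty]$, $$\int_{\mathbb R^3}|g|^2\ \le\ C\sum_{\substack{s\text{ dyadic}\\R^{-1/2}\le s\le1}}\ \sum_{\tau\in\mathbf S_s}\ \sum_{U\parallel U_{\tau,R}}|U|^{-1}\,\|S_Uf\|_{L^2}^4 .$$ -/

import Mathlib

open MeasureTheory
open scoped NNReal ENNReal FourierTransform SchwartzMap Pointwise

noncomputable section

namespace ConeSquare

/-- `ℝ³` with the Euclidean norm. -/
abbrev E3 : Type := EuclideanSpace ℝ (Fin 3)

/-- The truncated light cone `ξ₁² + ξ₂² = ξ₃²`, `1/2 ≤ |ξ₃| ≤ 1`. -/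
def cone : Set E3 :=
  {ξ | ξ 0 ^ 2 + ξ 1 ^ 2 = ξ 2 ^ 2 ∧ 1 / 2 ≤ |ξ 2| ∧ |ξ 2| ≤ 1}

/-- Core direction `c(ξ) = (ξ₁, ξ₂, 1)` at the point `ξ = (cos α, sin α, 1)` of the cone. -/
def coreDir (α : ℝ) : E3 := !₂[Real.cos α, Real.sin α, 1]

/-- Normal direction `n(ξ) = (ξ₁, ξ₂, -1)` at `ξ = (cos α, sin α, 1)`. -/
def normalDir (α : ℝ) : E3 := !₂[Real.cos α, Real.sin α, -1]

/-- Tangent direction `t(ξ) = (-ξ₂, ξ₁, 0)` at `ξ = (cos α, sin α, 1)`. -/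
def tangentDir (α : ℝ) : E3 := !₂[-Real.sin α, Real.cos α, 0]

/-- The sector `τ(s, ξ)` of aperture `s` and direction `ξ = (cos α, sin α, 1)`. -/
def sector (s α : ℝ) : Set E3 :=
  {ω | (1 ≤ inner ℝ (coreDir α) ω ∧ inner ℝ (coreDir α) ω ≤ 2) ∧
    |inner ℝ (normalDir α) ω| ≤ s ^ 2 ∧ |inner ℝ (tangentDir α) ω| ≤ s}

/-- The dilate `A τ(s, ξ)` of the rectangular box `τ(s, ξ)` about its centroid, the point with
`c(ξ) · ω = 3/2` and `n(ξ) · ω = t(ξ) · ω = 0`. -/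
def dilatedSector (A s α : ℝ) : Set E3 :=
  {ω | |inner ℝ (coreDir α) ω - 3 / 2| ≤ A / 2 ∧
    |inner ℝ (normalDir α) ω| ≤ A * s ^ 2 ∧ |inner ℝ (tangentDir α) ω| ≤ A * s}

/-- The number of directions at aperture `s`: `10 s⁻¹`, rounded up. -/
def numSectors (s : ℝ) : ℕ := ⌈10 / s⌉₊

/-- The angle of the `k`-th of the evenly spaced directions at aperture `s`; `φ s` is the angle of
the first one. The family `𝐒_s` consists of the sectors `sector s (angle φ s k)`. -/
def angle (φ : ℝ → ℝ) (s : ℝ) (k : Fin (numSectors s)) : ℝ :=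
  φ s + 2 * Real.pi * k / numSectors s

/-- The dyadic numbers `s` with `R^{-1/2} ≤ s ≤ 1`. -/
def dyadicScales (R : ℝ) : Set ℝ :=
  {s | (∃ m : ℤ, s = 2 ^ m) ∧ (√R)⁻¹ ≤ s ∧ s ≤ 1}

/-- The box `U_{τ,ρ}` for the sector `τ = τ(s, ξ)`, `ξ = (cos α, sin α, 1)`. -/
def plank (ρ s α : ℝ) : Set E3 :=
  {x | |inner ℝ (coreDir α) x| ≤ ρ * s ^ 2 ∧ |inner ℝ (normalDir α) x| ≤ ρ ∧
    |inner ℝ (tangentDir α) x| ≤ ρ * s}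

/-- The translates `v + U`, `v ∈ T`, tile `ℝ³`: they cover it and any two of them overlap in a
null set. -/
structure IsTiling (U : Set E3) (T : Set E3) : Prop where
  cover : ⋃ v ∈ T, (v +ᵥ U) = Set.univ
  overlap : T.Pairwise fun v w => AEDisjoint volume (v +ᵥ U) (w +ᵥ U)

/-- `f` is a function that defines a tempered distribution by integration, and the Fourier
transform of this distribution is supported in `K` (for `K` closed: it annihilates every test
function with support in the complement of `K`). -/
def HasFourierSupportIn (f : E3 → ℂ) (K : Set E3) : Prop :=
  ∃ u : 𝓢'(E3, ℂ),
    (∀ g : 𝓢(E3, ℂ), Integrable (fun x => g x • f x) ∧ u g = ∫ x, g x • f x) ∧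
    Distribution.IsVanishingOn (𝓕 u : 𝓢'(E3, ℂ)) Kᶜ

/-- The squared square function `∑_{θ ∈ B} |f_θ|²`. -/
def sqSum {ι : Type} (B : Finset ι) (fθ : ι → E3 → ℂ) (x : E3) : ℝ :=
  ∑ θ ∈ B, ‖fθ θ x‖ ^ 2

/-- The square function `S_U f = (∑_{θ ∈ B} |f_θ|²)^{1/2}` restricted to `U`. -/
def squareFn {ι : Type} (B : Finset ι) (fθ : ι → E3 → ℂ) (U : Set E3) : E3 → ℝ :=
  U.indicator fun x => √(sqSum B fθ x)

end ConeSquare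

end

noncomputable section

namespace ConeSquare

/-! The transform of `g` is a sum of pieces `F_θ`, the transforms of `|f_θ|²`, each supported in a
difference box of size `O(1)` along `c`, `O(1/R)` along `n` and `O(R^{-1/2})` along `t`. Fix a
frequency `ω`, let `Q` be the Lorentz form, put `M = max(1, R|ω₃|, R²|Q(ω)|)` and take a dyadic `s`
with `s² ~ 1/M`. All directions whose box contains `ω` have almost the same value of `(cos α, sin α)
· (ω₁, ω₂)`, so they form at most two clusters, told apart by the sign of `t · ω`, each of diameter
`O(s)` (`chordSq_mul_invApertureSq_le`). Hence the corresponding `θ` are assigned to `O(1)` sectors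
`τ` of aperture `s`, and `ω` lies in a dilate of the dual of `U_{τ,R}` for each of them
(`mem_dualPlank_of_chordSq_le`). `exists_adapted_scale` combines the two facts.

Cauchy-Schwarz over these few sectors (`enorm_sum_sq_le_of_fibers`) bounds `|ĝ(ω)|²` by a sum over
`s` and `τ` of `|∑_{θ ∈ A(τ)} F_θ(ω)|²` cut off to the dual plank. There the transform of the
normalized indicator of a small multiple of `U_{τ,R}` is at least `1/2`, so Plancherel leaves the
`L²` norm of local averages of `∑_{θ ∈ A(τ)} |f_θ|²`, which the averages over tiles control
(`setLIntegral_fourier_dualPlank_le`, `lintegral_average_sq_le`).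

This argument needs integrable `f_θ`. In general each `f_θ` is multiplied by transforms of shrinking
bumps (`HasFourierSupportIn.mul_bumpMultiplier`): these are bounded by `1`, so the right side does
not grow, and Fatou's lemma recovers the left side. -/

theorem inner_coreDir (α : ℝ) (ω : E3) :
    inner ℝ (coreDir α) ω = ω 0 * Real.cos α + ω 1 * Real.sin α + ω 2 := by
  simp [coreDir, PiLp.inner_apply, Fin.sum_univ_three]

theorem inner_normalDir (α : ℝ) (ω : E3) :
    inner ℝ (normalDir α) ω = ω 0 * Real.cos α + ω 1 * Real.sin α - ω 2 := by
  simp [normalDir, PiLp.inner_apply, Fin.sum_univ_three]; ring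

theorem inner_tangentDir (α : ℝ) (ω : E3) :
    inner ℝ (tangentDir α) ω = ω 1 * Real.cos α - ω 0 * Real.sin α := by
  simp [tangentDir, PiLp.inner_apply, Fin.sum_univ_three]; ring

/-! ### Chord distance and the Lorentz form -/

/-- The squared chord between the points of the unit circle at the angles `α` and `β`. -/
def chordSq (α β : ℝ) : ℝ :=
  (Real.cos α - Real.cos β) ^ 2 + (Real.sin α - Real.sin β) ^ 2

theorem chordSq_nonneg (α β : ℝ) : 0 ≤ chordSq α β := by unfold chordSq; positivity

theorem chordSq_comm (α β : ℝ) : chordSq α β = chordSq β α := by unfold chordSq; ring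

theorem chordSq_le_four (α β : ℝ) : chordSq α β ≤ 4 := by
  unfold chordSq
  nlinarith [sq_nonneg (Real.cos α + Real.cos β), sq_nonneg (Real.sin α + Real.sin β),
    Real.sin_sq_add_cos_sq α, Real.sin_sq_add_cos_sq β]

/-- For the three points `P_α`, `P_β`, `P_γ` of the circle, the right side minus the left is `|P_α -
2 P_β + P_γ|²`. -/
theorem chordSq_triangle (α β γ : ℝ) :
    chordSq α γ ≤ 2 * chordSq α β + 2 * chordSq β γ := by
  unfold chordSq
  nlinarith [sq_nonneg (Real.cos α - 2 * Real.cos β + Real.cos γ),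
    sq_nonneg (Real.sin α - 2 * Real.sin β + Real.sin γ)]

theorem chordSq_eq_sin_sq (α β : ℝ) : chordSq α β = 4 * Real.sin ((α - β) / 2) ^ 2 := by
  have h := Real.cos_sub α β
  have h2 : Real.cos (α - β) = 1 - 2 * Real.sin ((α - β) / 2) ^ 2 := by
    have := Real.cos_two_mul ((α - β) / 2)
    rw [show 2 * ((α - β) / 2) = α - β by ring] at this
    nlinarith [Real.sin_sq_add_cos_sq ((α - β) / 2)]
  unfold chordSq
  nlinarith [Real.sin_sq_add_cos_sq α, Real.sin_sq_add_cos_sq β]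

/-- The Lorentz form `ω₁² + ω₂² - ω₃²`. -/
def lorentz (ω : E3) : ℝ := ω 0 ^ 2 + ω 1 ^ 2 - ω 2 ^ 2

/-- The vectors `c` and `n` are null for the form. Since the form does not depend on `α`, it ties
together the components of `ω` in the frames of all directions. -/
theorem lorentz_eq (α : ℝ) (ω : E3) :
    lorentz ω = inner ℝ (tangentDir α) ω ^ 2 +
      inner ℝ (normalDir α) ω * inner ℝ (coreDir α) ω := by
  rw [inner_coreDir, inner_normalDir, inner_tangentDir, lorentz]
  linear_combination (-(ω 0 ^ 2 + ω 1 ^ 2)) * Real.sin_sq_add_cos_sq α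

/-- Two sectors that meet have directions at distance comparable to the larger aperture. -/
theorem chordSq_le_of_sector_inter {r s α β : ℝ} (hr : 0 ≤ r) (hrs : r ≤ s)
    (h : (sector r α ∩ sector s β).Nonempty) : chordSq α β ≤ 256 * s ^ 2 := by
  obtain ⟨ω, ⟨⟨h1, h2⟩, h3, h4⟩, ⟨⟨h5, h6⟩, h7, h8⟩⟩ := h
  rw [inner_coreDir] at h1 h2 h5 h6
  rw [inner_normalDir] at h3 h7
  rw [inner_tangentDir] at h4 h8
  have hs0 : 0 ≤ s := hr.trans hrs
  by_cases hsm : 1 / 2 ≤ s ^ 2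
  · linarith [chordSq_le_four α β]
  push Not at hsm
  have hr2 : r ^ 2 ≤ s ^ 2 := by gcongr
  -- The horizontal part of `ω` is within `O(s)` of the point of the circle of radius `ω 2` at angle
  -- `γ`: the square of this distance is exactly `n² + t²`.
  have key : ∀ γ : ℝ, |ω 0 * Real.cos γ + ω 1 * Real.sin γ - ω 2| ≤ s ^ 2 →
      |ω 1 * Real.cos γ - ω 0 * Real.sin γ| ≤ s →
      (ω 0 - ω 2 * Real.cos γ) ^ 2 + (ω 1 - ω 2 * Real.sin γ) ^ 2 ≤ 2 * s ^ 2 := by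
    intro γ hn ht
    have e : (ω 0 - ω 2 * Real.cos γ) ^ 2 + (ω 1 - ω 2 * Real.sin γ) ^ 2 =
        (ω 0 * Real.cos γ + ω 1 * Real.sin γ - ω 2) ^ 2 +
        (ω 1 * Real.cos γ - ω 0 * Real.sin γ) ^ 2 := by
      linear_combination (-(ω 0 ^ 2 + ω 1 ^ 2) + ω 2 ^ 2) * Real.sin_sq_add_cos_sq γ
    have h1 := sq_le_sq' (abs_le.mp hn).1 (abs_le.mp hn).2
    have h2 := sq_le_sq' (abs_le.mp ht).1 (abs_le.mp ht).2
    have h3 : (s ^ 2) ^ 2 ≤ s ^ 2 := by nlinarith [sq_nonneg s]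
    linarith
  have ka := key α (h3.trans hr2) (h4.trans hrs)
  have kb := key β h7 h8
  -- Here `c - n = 2 ω₃`, with `c ≥ 1` and `n ≤ s² < 1/2`; dividing by `ω 2` therefore costs only a
  -- constant.
  have hz : 1 / 4 ≤ ω 2 := by
    have := (abs_le.mp h7).2
    linarith
  have hz2 : 1 / 16 ≤ ω 2 ^ 2 := by nlinarith
  have : ω 2 ^ 2 * chordSq α β ≤ 8 * s ^ 2 := by
    unfold chordSq
    nlinarith [sq_nonneg ((ω 0 - ω 2 * Real.cos α) + (ω 0 - ω 2 * Real.cos β)),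
      sq_nonneg ((ω 1 - ω 2 * Real.sin α) + (ω 1 - ω 2 * Real.sin β))]
  nlinarith [chordSq_nonneg α β]

/-! ### Difference boxes, dual planks and the adapted aperture -/

/-- Two vectors `(x₁, t₁)`, `(x₂, t₂)` of the same length `a`, in the same half plane, whose first
coordinates are `ε`-close: bounds on the (squared) angle between them. -/
theorem sq_dist_bounds_of_same_side {x₁ t₁ x₂ t₂ a ε D : ℝ} (ha : 0 ≤ a) (hε : 0 ≤ ε)
    (h₁ : x₁ ^ 2 + t₁ ^ 2 = a ^ 2) (h₂ : x₂ ^ 2 + t₂ ^ 2 = a ^ 2)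
    (hx : |x₁ - x₂| ≤ ε) (ht : 0 ≤ t₁ * t₂)
    (hD : (x₁ - x₂) ^ 2 + (t₁ - t₂) ^ 2 = a ^ 2 * D) :
    a * D ≤ 4 * ε ∧ t₁ ^ 2 * D ≤ 5 * ε ^ 2 := by
  rcases ha.eq_or_lt with rfl | ha
  · have : t₁ = 0 := by nlinarith [sq_nonneg x₁, sq_nonneg t₁]
    subst this
    constructor <;> nlinarith [sq_nonneg ε]
  have e : (t₁ - t₂) * (t₁ + t₂) = (x₂ - x₁) * (x₁ + x₂) := by linear_combination h₁ - h₂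
  have hx1 : |x₁| ≤ a := abs_le_of_sq_le_sq (by nlinarith [sq_nonneg t₁]) ha.le
  have hx2 : |x₂| ≤ a := abs_le_of_sq_le_sq (by nlinarith [sq_nonneg t₂]) ha.le
  have hs : |x₁ + x₂| ≤ 2 * a := (abs_add_le _ _).trans (by linarith)
  have hd : |x₁ - x₂| ≤ 2 * a := (abs_sub _ _).trans (by linarith)
  have hp : |t₁ - t₂| * |t₁ + t₂| ≤ ε * (2 * a) := by
    rw [← abs_mul, e, abs_mul, abs_sub_comm]
    exact mul_le_mul hx hs (abs_nonneg _) hε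
  have hx2' : (x₁ - x₂) ^ 2 ≤ ε * (2 * a) := by
    rw [← sq_abs, sq]
    exact mul_le_mul hx hd (abs_nonneg _) hε
  -- The same-side hypothesis enters here: it excludes the mirror image `t₂ ≈ -t₁`, for which equal
  -- lengths and close first coordinates would not force closeness.
  have htt : |t₁ - t₂| ≤ |t₁ + t₂| := sq_le_sq.mp (by nlinarith)
  have ht2 : (t₁ - t₂) ^ 2 ≤ ε * (2 * a) := by
    rw [← sq_abs, sq]
    exact (mul_le_mul_of_nonneg_left htt (abs_nonneg _)).trans hp
  have ht1 : t₁ ^ 2 ≤ (t₁ + t₂) ^ 2 := by nlinarith [sq_nonneg t₂]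
  have hp2 : (t₁ - t₂) ^ 2 * (t₁ + t₂) ^ 2 ≤ (ε * (2 * a)) ^ 2 := by
    rw [← sq_abs (t₁ - t₂), ← sq_abs (t₁ + t₂), ← mul_pow]
    gcongr
  have hxx : (x₁ - x₂) ^ 2 ≤ ε ^ 2 := by rw [← sq_abs]; gcongr
  have ht1a : t₁ ^ 2 ≤ a ^ 2 := by nlinarith [sq_nonneg x₁]
  constructor
  · refine le_of_mul_le_mul_left ?_ ha
    nlinarith
  · refine le_of_mul_le_mul_left ?_ (pow_pos ha 2)
    have i1 : t₁ ^ 2 * (x₁ - x₂) ^ 2 ≤ a ^ 2 * ε ^ 2 := by gcongr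
    have i2 : t₁ ^ 2 * (t₁ - t₂) ^ 2 ≤ (t₁ + t₂) ^ 2 * (t₁ - t₂) ^ 2 := by gcongr
    calc a ^ 2 * (t₁ ^ 2 * D) = t₁ ^ 2 * (x₁ - x₂) ^ 2 + t₁ ^ 2 * (t₁ - t₂) ^ 2 := by
          linear_combination (-t₁ ^ 2) * hD
      _ ≤ _ := by nlinarith

/-- A box that contains the differences of the points of a dilated sector of
aperture `R^{-1/2}`. -/
def differenceBox (K R α : ℝ) : Set E3 :=
  {ω | |inner ℝ (coreDir α) ω| ≤ K ∧ |inner ℝ (normalDir α) ω| ≤ K / R ∧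
    |inner ℝ (tangentDir α) ω| ≤ K / √R}

/-- The dilate by `C` of the box dual to the plank `U_{τ,R}`. -/
def dualPlank (C R s α : ℝ) : Set E3 :=
  {ω | |inner ℝ (coreDir α) ω| ≤ C / (R * s ^ 2) ∧ |inner ℝ (normalDir α) ω| ≤ C / R ∧
    |inner ℝ (tangentDir α) ω| ≤ C / (R * s)}

/-- The square of the inverse of the aperture adapted to the frequency `ω`. -/
def invApertureSq (R : ℝ) (ω : E3) : ℝ := max 1 (max (R * |ω 2|) (R ^ 2 * |lorentz ω|))

theorem one_le_invApertureSq (R : ℝ) (ω : E3) : 1 ≤ invApertureSq R ω := le_max_left _ _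

theorem mul_abs_le_invApertureSq (R : ℝ) (ω : E3) : R * |ω 2| ≤ invApertureSq R ω :=
  (le_max_left _ _).trans (le_max_right _ _)

theorem mul_abs_lorentz_le_invApertureSq (R : ℝ) (ω : E3) :
    R ^ 2 * |lorentz ω| ≤ invApertureSq R ω :=
  (le_max_right _ _).trans (le_max_right _ _)

theorem inner_coreDir_eq_add (α : ℝ) (ω : E3) :
    inner ℝ (coreDir α) ω = inner ℝ (normalDir α) ω + 2 * ω 2 := by
  rw [inner_coreDir, inner_normalDir]; ring

theorem abs_lorentz_le (α : ℝ) (ω : E3) :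
    |lorentz ω| ≤ inner ℝ (tangentDir α) ω ^ 2 +
      |inner ℝ (normalDir α) ω| * |inner ℝ (coreDir α) ω| := by
  rw [lorentz_eq α, ← abs_mul]
  exact (abs_add_le _ _).trans (by rw [abs_of_nonneg (sq_nonneg _)])

theorem sq_inner_tangentDir_le (α : ℝ) (ω : E3) :
    inner ℝ (tangentDir α) ω ^ 2 ≤ |lorentz ω| +
      |inner ℝ (normalDir α) ω| * |inner ℝ (coreDir α) ω| := by
  rw [← abs_mul]
  have h := lorentz_eq α ω
  linarith [le_abs_self (lorentz ω),
    neg_abs_le (inner ℝ (normalDir α) ω * inner ℝ (coreDir α) ω)]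

/-- In the box `|ω₃| = O(1)`, and `t²` and `n c` are both `O(1/R)`, hence so is the Lorentz form.
The adapted aperture is thus at least of order `R^{-1/2}`, the smallest scale available. -/
theorem invApertureSq_le {K R α : ℝ} (hK : 1 ≤ K) (hR : 1 ≤ R) {ω : E3}
    (h : ω ∈ differenceBox K R α) : invApertureSq R ω ≤ 2 * K ^ 2 * R := by
  obtain ⟨hc, hn, ht⟩ := h
  have hR0 : 0 < R := by linarith
  have hn' : R * |inner ℝ (normalDir α) ω| ≤ K := by
    rw [le_div_iff₀ hR0] at hn; linarith
  have ht' : R * inner ℝ (tangentDir α) ω ^ 2 ≤ K ^ 2 := by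
    have := pow_le_pow_left₀ (abs_nonneg _) ht 2
    rw [sq_abs, div_pow, Real.sq_sqrt hR0.le, le_div_iff₀ hR0] at this
    linarith
  have hz : 2 * |ω 2| ≤ |inner ℝ (coreDir α) ω| + |inner ℝ (normalDir α) ω| := by
    rw [← abs_two, ← abs_mul, show 2 * ω 2 = inner ℝ (coreDir α) ω - inner ℝ (normalDir α) ω by
      rw [inner_coreDir_eq_add]; ring]
    exact abs_sub _ _
  have hnc : R * (|inner ℝ (normalDir α) ω| * |inner ℝ (coreDir α) ω|) ≤ K * K := by
    rw [← mul_assoc]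
    exact mul_le_mul hn' hc (abs_nonneg _) (by linarith)
  refine max_le ?_ (max_le ?_ ?_)
  · nlinarith
  · have h1 : R * |ω 2| ≤ K * R := by nlinarith
    have h2 : K * R ≤ K ^ 2 * R := by gcongr; exact le_self_pow₀ hK two_ne_zero
    have h3 : 0 ≤ K ^ 2 * R := by positivity
    linarith
  · calc R ^ 2 * |lorentz ω| ≤ R * (R * inner ℝ (tangentDir α) ω ^ 2 +
          R * (|inner ℝ (normalDir α) ω| * |inner ℝ (coreDir α) ω|)) := by
          have := mul_le_mul_of_nonneg_left (abs_lorentz_le α ω) (sq_nonneg R)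
          linarith
      _ ≤ R * (K ^ 2 + K * K) := by gcongr
      _ = _ := by ring

/-- The directions, on one side of `ω`, whose difference box contains `ω`, lie within the adapted
aperture of each other. -/
theorem chordSq_mul_invApertureSq_le {K R α β : ℝ} (hK : 1 ≤ K) (hR : 1 ≤ R) {ω : E3}
    (hα : ω ∈ differenceBox K R α) (hβ : ω ∈ differenceBox K R β)
    (hside : 0 ≤ inner ℝ (tangentDir α) ω * inner ℝ (tangentDir β) ω) :
    chordSq α β * invApertureSq R ω ≤ 48 * K ^ 2 := by
  obtain ⟨-, hn, -⟩ := hα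
  obtain ⟨-, hn', -⟩ := hβ
  have hR0 : 0 < R := by linarith
  have hK0 : 0 < K := by linarith
  set D := chordSq α β with hD
  have hD0 : 0 ≤ D := chordSq_nonneg α β
  have hD4 : D ≤ 4 := chordSq_le_four α β
  set a := √(ω 0 ^ 2 + ω 1 ^ 2) with ha
  have ha2 : a ^ 2 = ω 0 ^ 2 + ω 1 ^ 2 := Real.sq_sqrt (by positivity)
  -- In the frame rotated by `γ` the horizontal part of `ω` has coordinates `(n + ω₃, t)`, of length
  -- `a` for every `γ`. As `n = O(K/R)` at both angles, the first coordinates nearly agree.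
  have hx : |(inner ℝ (normalDir α) ω + ω 2) - (inner ℝ (normalDir β) ω + ω 2)| ≤ 2 * K / R := by
    rw [add_sub_add_right_eq_sub]
    exact (abs_sub _ _).trans (by rw [mul_div_assoc]; linarith)
  have hl (γ : ℝ) : (inner ℝ (normalDir γ) ω + ω 2) ^ 2 + inner ℝ (tangentDir γ) ω ^ 2 = a ^ 2 := by
    rw [ha2, inner_normalDir, inner_tangentDir]
    linear_combination (ω 0 ^ 2 + ω 1 ^ 2) * Real.sin_sq_add_cos_sq γ
  obtain ⟨i1, i2⟩ := sq_dist_bounds_of_same_side (D := D) (Real.sqrt_nonneg _)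
    (show 0 ≤ 2 * K / R by positivity) (hl α) (hl β) hx hside
    (by
      rw [ha2, hD, inner_normalDir, inner_tangentDir, inner_normalDir, inner_tangentDir, chordSq]
      ring)
  have hz : |ω 2| ≤ a + K / R := by
    have h1 : |inner ℝ (normalDir α) ω + ω 2| ≤ a :=
      abs_le_of_sq_le_sq (by nlinarith [hl α, sq_nonneg (inner ℝ (tangentDir α) ω)])
        (Real.sqrt_nonneg _)
    have h2 : |ω 2| ≤ |inner ℝ (normalDir α) ω + ω 2| + |inner ℝ (normalDir α) ω| := by
      conv_lhs => rw [show ω 2 = (inner ℝ (normalDir α) ω + ω 2) - inner ℝ (normalDir α) ω by ring]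
      exact abs_sub _ _
    linarith
  have hKR : R * (K / R) = K := by field_simp
  have hRa : R * (a * D) ≤ 8 * K := by
    calc R * (a * D) ≤ R * (4 * (2 * K / R)) := by gcongr
      _ = _ := by field_simp; ring
  have hRz : R * |ω 2| * D ≤ 12 * K := by
    calc R * |ω 2| * D ≤ R * (a + K / R) * D := by gcongr
      _ = R * (a * D) + K * D := by rw [mul_add, hKR]; ring
      _ ≤ 12 * K := by nlinarith
  have hRt : R ^ 2 * (inner ℝ (tangentDir α) ω ^ 2 * D) ≤ 20 * K ^ 2 := by
    calc R ^ 2 * (inner ℝ (tangentDir α) ω ^ 2 * D) ≤ R ^ 2 * (5 * (2 * K / R) ^ 2) := by gcongr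
      _ = _ := by field_simp; ring
  have hnR : R * |inner ℝ (normalDir α) ω| ≤ K := by
    rw [le_div_iff₀ hR0] at hn; linarith
  have hRc : R * |inner ℝ (coreDir α) ω| * D ≤ 28 * K := by
    have : |inner ℝ (coreDir α) ω| ≤ |inner ℝ (normalDir α) ω| + 2 * |ω 2| := by
      rw [inner_coreDir_eq_add]
      exact (abs_add_le _ _).trans (by rw [abs_mul, abs_two])
    calc R * |inner ℝ (coreDir α) ω| * D
        ≤ R * (|inner ℝ (normalDir α) ω| + 2 * |ω 2|) * D := by gcongr
      _ = R * |inner ℝ (normalDir α) ω| * D + 2 * (R * |ω 2| * D) := by ring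
      _ ≤ K * 4 + 2 * (12 * K) := by gcongr
      _ = _ := by ring
  have hRQ : R ^ 2 * |lorentz ω| * D ≤ 48 * K ^ 2 := by
    calc R ^ 2 * |lorentz ω| * D ≤ R ^ 2 * (inner ℝ (tangentDir α) ω ^ 2 +
          |inner ℝ (normalDir α) ω| * |inner ℝ (coreDir α) ω|) * D := by
          gcongr; exact abs_lorentz_le α ω
      _ = R ^ 2 * (inner ℝ (tangentDir α) ω ^ 2 * D) +
          (R * |inner ℝ (normalDir α) ω|) * (R * |inner ℝ (coreDir α) ω| * D) := by ring
      _ ≤ 20 * K ^ 2 + K * (28 * K) := by gcongr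
      _ = _ := by ring
  unfold invApertureSq
  rw [mul_max_of_nonneg _ _ hD0, mul_max_of_nonneg _ _ hD0]
  refine max_le (by nlinarith) (max_le ?_ ?_)
  · nlinarith
  · linarith

/-- If `ω` lies in the difference box at the angle `α`, then it lies in a dilate of the dual plank
at every angle `β` within the adapted aperture `s`. -/
theorem mem_dualPlank_of_chordSq_le {K L R s α β : ℝ} (hK : 1 ≤ K) (hL : 1 ≤ L) (hR : 1 ≤ R)
    (hs0 : 0 < s) (hs1 : s ≤ 1) {ω : E3} (hα : ω ∈ differenceBox K R α)
    (hM : invApertureSq R ω * s ^ 2 ≤ L) (hd : chordSq α β ≤ 256 * s ^ 2) :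
    ω ∈ dualPlank (1000 * (K + L) ^ 2) R s β := by
  obtain ⟨-, hn, -⟩ := hα
  have hR0 : 0 < R := by linarith
  have hs2 : s ^ 2 ≤ 1 := pow_le_one₀ hs0.le hs1
  set n := inner ℝ (normalDir α) ω with hndef
  set t := inner ℝ (tangentDir α) ω with htdef
  have hnR : R * |n| ≤ K := by rw [le_div_iff₀ hR0] at hn; linarith
  have hz : R * |ω 2| * s ^ 2 ≤ L := by
    refine le_trans ?_ hM
    gcongr
    exact mul_abs_le_invApertureSq R ω
  have hQ : R ^ 2 * |lorentz ω| * s ^ 2 ≤ L := by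
    refine le_trans ?_ hM
    gcongr
    exact mul_abs_lorentz_le_invApertureSq R ω
  have hns : R * |n| * s ^ 2 ≤ K := by
    calc R * |n| * s ^ 2 ≤ K * 1 := by gcongr
      _ = K := mul_one K
  have hcs : R * |inner ℝ (coreDir α) ω| * s ^ 2 ≤ K + 2 * L := by
    have : |inner ℝ (coreDir α) ω| ≤ |n| + 2 * |ω 2| := by
      rw [inner_coreDir_eq_add]
      exact (abs_add_le _ _).trans (by rw [abs_mul, abs_two])
    calc R * |inner ℝ (coreDir α) ω| * s ^ 2 ≤ R * (|n| + 2 * |ω 2|) * s ^ 2 := by gcongr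
      _ = R * |n| * s ^ 2 + 2 * (R * |ω 2| * s ^ 2) := by ring
      _ ≤ _ := by linarith
  -- The size of the box alone gives only `|t| = O(R^{-1/2})`. The stronger bound comes from `t² = Q
  -- - n c`, where both terms are small by the choice of aperture.
  have ht : R * |t| * s ≤ 2 * (K + L) := by
    refine abs_le_of_sq_le_sq' ?_ (by linarith) |>.2
    calc (R * |t| * s) ^ 2 = R ^ 2 * t ^ 2 * s ^ 2 := by rw [mul_pow, mul_pow, sq_abs]
      _ ≤ R ^ 2 * (|lorentz ω| + |n| * |inner ℝ (coreDir α) ω|) * s ^ 2 := by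
          gcongr; exact sq_inner_tangentDir_le α ω
      _ = R ^ 2 * |lorentz ω| * s ^ 2 + (R * |n|) * (R * |inner ℝ (coreDir α) ω| * s ^ 2) := by
          ring
      _ ≤ L + K * (K + 2 * L) := by gcongr
      _ ≤ _ := by nlinarith
  have hX : R * |n + ω 2| * s ^ 2 ≤ K + L := by
    calc R * |n + ω 2| * s ^ 2 ≤ R * (|n| + |ω 2|) * s ^ 2 := by gcongr; exact abs_add_le _ _
      _ = R * |n| * s ^ 2 + R * |ω 2| * s ^ 2 := by ring
      _ ≤ _ := by linarith
  -- the coordinates `u`, `v` of the point at angle `β` in the frame at angle `α`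
  set u := Real.cos β * Real.cos α + Real.sin β * Real.sin α with hu
  set v := Real.sin β * Real.cos α - Real.cos β * Real.sin α with hv
  have hu1 : 1 - u = chordSq α β / 2 := by
    unfold chordSq
    linear_combination (-1 / 2 : ℝ) * Real.sin_sq_add_cos_sq α -
      (1 / 2 : ℝ) * Real.sin_sq_add_cos_sq β
  have huv : u ^ 2 + v ^ 2 = 1 := by
    rw [hu, hv]
    linear_combination (Real.sin β ^ 2 + Real.cos β ^ 2) * Real.sin_sq_add_cos_sq α +
      Real.sin_sq_add_cos_sq β
  have huD : |u - 1| ≤ 128 * s ^ 2 := by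
    rw [abs_sub_comm, abs_of_nonneg (by linarith [chordSq_nonneg α β])]; linarith
  -- `u` and `v` are the cosine and sine of `β - α`, so `v² = 1 - u² ≤ 2 (1 - u)`, which is the
  -- squared chord.
  have hv16 : |v| ≤ 16 * s := by
    refine abs_le_of_sq_le_sq ?_ (by linarith)
    have : v ^ 2 ≤ 2 * (1 - u) := by nlinarith [sq_nonneg (1 - u)]
    nlinarith
  have hu_le : |u| ≤ 1 := abs_le_of_sq_le_sq (by nlinarith [sq_nonneg v]) zero_le_one
  have en : inner ℝ (normalDir β) ω = n + (n + ω 2) * (u - 1) + t * v := by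
    rw [hndef, htdef, inner_normalDir, inner_normalDir, inner_tangentDir, hu, hv]
    linear_combination (-(ω 0 * Real.cos β + ω 1 * Real.sin β)) * Real.sin_sq_add_cos_sq α
  have et : inner ℝ (tangentDir β) ω = t * u - (n + ω 2) * v := by
    rw [hndef, htdef, inner_normalDir, inner_tangentDir, inner_tangentDir, hu, hv]
    linear_combination (-(ω 1 * Real.cos β - ω 0 * Real.sin β)) * Real.sin_sq_add_cos_sq α
  have bn : R * |inner ℝ (normalDir β) ω| ≤ 161 * (K + L) := by
    rw [en]
    calc R * |n + (n + ω 2) * (u - 1) + t * v|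
        ≤ R * (|n| + |n + ω 2| * |u - 1| + |t| * |v|) := by
          gcongr
          rw [← abs_mul, ← abs_mul]
          exact (abs_add_le _ _).trans (by gcongr; exact abs_add_le _ _)
      _ ≤ R * (|n| + |n + ω 2| * (128 * s ^ 2) + |t| * (16 * s)) := by gcongr
      _ = R * |n| + 128 * (R * |n + ω 2| * s ^ 2) + 16 * (R * |t| * s) := by ring
      _ ≤ _ := by linarith
  have bt : R * |inner ℝ (tangentDir β) ω| * s ≤ 18 * (K + L) := by
    rw [et]
    calc R * |t * u - (n + ω 2) * v| * s
        ≤ R * (|t| * |u| + |n + ω 2| * |v|) * s := by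
          gcongr
          rw [← abs_mul, ← abs_mul]
          exact abs_sub _ _
      _ ≤ R * (|t| * 1 + |n + ω 2| * (16 * s)) * s := by gcongr
      _ = R * |t| * s + 16 * (R * |n + ω 2| * s ^ 2) := by ring
      _ ≤ _ := by linarith
  have bc : R * |inner ℝ (coreDir β) ω| * s ^ 2 ≤ 163 * (K + L) := by
    have : |inner ℝ (coreDir β) ω| ≤ |inner ℝ (normalDir β) ω| + 2 * |ω 2| := by
      rw [inner_coreDir_eq_add]
      exact (abs_add_le _ _).trans (by rw [abs_mul, abs_two])
    calc R * |inner ℝ (coreDir β) ω| * s ^ 2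
        ≤ R * (|inner ℝ (normalDir β) ω| + 2 * |ω 2|) * s ^ 2 := by gcongr
      _ = R * |inner ℝ (normalDir β) ω| * s ^ 2 + 2 * (R * |ω 2| * s ^ 2) := by ring
      _ ≤ 161 * (K + L) * 1 + 2 * L := by gcongr
      _ ≤ _ := by linarith
  -- The three bounds are linear in `K + L`; this absorbs them into the single constant `1000 (K +
  -- L)²`.
  have hKL : K + L ≤ (K + L) ^ 2 := le_self_pow₀ (by linarith) two_ne_zero
  refine ⟨?_, ?_, ?_⟩
  · rw [le_div_iff₀ (by positivity)]; linarith
  · rw [le_div_iff₀ hR0]; linarith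
  · rw [le_div_iff₀ (by positivity)]; linarith

/-! ### Choice of the scale and counting of sectors -/

/-- For `1 ≤ M ≤ B R` there is a dyadic `s ∈ [R^{-1/2}, 1]` with `s² ~ M⁻¹`. -/
theorem exists_dyadicScale {M B R : ℝ} (hR : 1 ≤ R) (hM : 1 ≤ M) (hB : 1 ≤ B) (hMB : M ≤ B * R) :
    ∃ s ∈ dyadicScales R, 1 ≤ M * s ^ 2 ∧ M * s ^ 2 ≤ 4 * B := by
  have hR0 : 0 < R := by linarith
  have hM0 : 0 < M := by linarith
  have hsR : 0 < √R := Real.sqrt_pos.2 hR0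
  have hsM : 0 < √M := Real.sqrt_pos.2 hM0
  have hx0 : 0 < max (√M)⁻¹ (√R)⁻¹ := lt_max_of_lt_left (by positivity)
  have hx1 : max (√M)⁻¹ (√R)⁻¹ ≤ 1 :=
    max_le (inv_le_one_of_one_le₀ (Real.one_le_sqrt.2 hM))
      (inv_le_one_of_one_le₀ (Real.one_le_sqrt.2 hR))
  -- The smallest power of `1/2` that is at least `max(M^{-1/2}, R^{-1/2})`; it is less than twice
  -- this maximum, whence the factor `4` after squaring.
  obtain ⟨n, hn1, hn2⟩ := exists_nat_pow_near_of_lt_one hx0 hx1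
    (show (0 : ℝ) < 1 / 2 by norm_num) (by norm_num)
  refine ⟨(1 / 2) ^ n, ⟨⟨-n, by simp⟩, (le_max_right _ _).trans hn2,
    pow_le_one₀ (by norm_num) (by norm_num)⟩, ?_, ?_⟩
  · have h := pow_le_pow_left₀ (by positivity) ((le_max_left _ _).trans hn2) 2
    rw [inv_pow, Real.sq_sqrt hM0.le] at h
    calc 1 = M * M⁻¹ := by field_simp
      _ ≤ _ := by gcongr
  · set s : ℝ := (1 / 2) ^ n with hs
    have hs0 : 0 < s := by positivity
    have hlt : s < 2 * max (√M)⁻¹ (√R)⁻¹ := by rw [pow_succ] at hn1; linarith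
    have h2 : s ^ 2 ≤ 4 * max M⁻¹ R⁻¹ := by
      have h := pow_le_pow_left₀ hs0.le hlt.le 2
      rw [mul_pow] at h
      refine h.trans ?_
      rcases le_total (√M)⁻¹ (√R)⁻¹ with h' | h'
      · rw [max_eq_right h', inv_pow, Real.sq_sqrt hR0.le]
        nlinarith [le_max_right M⁻¹ R⁻¹]
      · rw [max_eq_left h', inv_pow, Real.sq_sqrt hM0.le]
        nlinarith [le_max_left M⁻¹ R⁻¹]
    calc M * s ^ 2 ≤ M * (4 * max M⁻¹ R⁻¹) := by gcongr
      _ = 4 * max (M * M⁻¹) (M * R⁻¹) := by rw [← mul_max_of_nonneg _ _ hM0.le]; ring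
      _ ≤ 4 * B := by
        gcongr
        refine max_le ?_ ?_
        · rw [mul_inv_cancel₀ hM0.ne']; exact hB
        · rw [← div_eq_mul_inv, div_le_iff₀ hR0]; exact hMB

theorem numSectors_pos {s : ℝ} (hs0 : 0 < s) : 0 < numSectors s :=
  Nat.ceil_pos.2 (by positivity)

theorem mul_numSectors_le {s : ℝ} (hs0 : 0 < s) (hs1 : s ≤ 1) : s * numSectors s ≤ 11 := by
  have h := (Nat.ceil_lt_add_one (show 0 ≤ 10 / s by positivity)).le
  calc s * numSectors s ≤ s * (10 / s + 1) := by unfold numSectors; gcongr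
    _ = 10 + s := by field_simp
    _ ≤ 11 := by linarith

/-- Evenly spaced directions within `O(s)` of a given one have indices within `O(1)`, cyclically. -/
theorem abs_sub_le_of_chordSq_le {φ : ℝ → ℝ} {s B : ℝ} {m : ℕ} (hs0 : 0 < s) (hs1 : s ≤ 1)
    (hm : 8 * B ≤ m ^ 2) {k l : Fin (numSectors s)}
    (h : chordSq (angle φ s k) (angle φ s l) ≤ B * s ^ 2) :
    |(k : ℤ) - l| ≤ m ∨ (numSectors s : ℤ) - m ≤ |(k : ℤ) - l| := by
  set n : ℝ := (numSectors s : ℝ) with hn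
  have hn0 : 0 < n := by rw [hn]; exact_mod_cast numSectors_pos hs0
  set j : ℤ := |(k : ℤ) - l| with hj
  have hjn : j ≤ numSectors s := by rw [hj, abs_le]; constructor <;> omega
  have hj0 : 0 ≤ j := abs_nonneg _
  have hjr0 : (0 : ℝ) ≤ j := by exact_mod_cast hj0
  have hjrn : (j : ℝ) ≤ n := by rw [hn]; exact_mod_cast hjn
  have hsin : Real.sin ((angle φ s k - angle φ s l) / 2) ^ 2 = Real.sin (Real.pi * (j / n)) ^ 2 := by
    have e : (angle φ s k - angle φ s l) / 2 = Real.pi * ((((k : ℤ) - l : ℤ) : ℝ) / n) := by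
      unfold angle; rw [← hn]; push_cast; field_simp; ring
    rw [e, hj]
    rcases abs_cases ((k : ℤ) - l) with ⟨h1, -⟩ | ⟨h1, -⟩
    · rw [h1]
    · rw [h1, Int.cast_neg, neg_div, mul_neg, Real.sin_neg, neg_sq]
  rw [chordSq_eq_sin_sq, hsin] at h
  have hsn : (s * n) ^ 2 ≤ 121 :=
    (pow_le_pow_left₀ (by positivity) (mul_numSectors_le hs0 hs1) 2).trans (by norm_num)
  have hB : 0 ≤ B := by
    by_contra hB
    push Not at hB
    nlinarith [sq_nonneg (Real.sin (Real.pi * (j / n))), pow_pos hs0 2]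
  -- `y` is the distance of `j / n` to the nearest integer
  have key : ∀ y : ℝ, 0 ≤ y → y ≤ 1 / 2 → Real.sin (Real.pi * y) ^ 2 =
      Real.sin (Real.pi * (j / n)) ^ 2 → n * y ≤ m := by
    intro y hy0 hy1 hy
    -- Jordan's inequality, valid as `π y ≤ π / 2`.
    have hle : 2 * y ≤ Real.sin (Real.pi * y) := by
      have := Real.mul_le_sin (x := Real.pi * y) (by positivity) (by nlinarith [Real.pi_pos])
      calc 2 * y = 2 / Real.pi * (Real.pi * y) := by field_simp
        _ ≤ _ := this
    have h1 : (2 * y) ^ 2 ≤ Real.sin (Real.pi * y) ^ 2 := by gcongr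
    refine abs_le_of_sq_le_sq' ?_ (by positivity) |>.2
    have h2 : 16 * y ^ 2 ≤ B * s ^ 2 := by rw [hy] at h1; nlinarith
    calc (n * y) ^ 2 = (16 * y ^ 2) * n ^ 2 / 16 := by ring
      _ ≤ (B * s ^ 2) * n ^ 2 / 16 := by gcongr
      _ = B * (s * n) ^ 2 / 16 := by ring
      -- There are at most `11 / s` directions, and `121 / 16 < 8` explains the `8` in the
      -- hypothesis on `m`.
      _ ≤ B * 121 / 16 := by gcongr
      _ ≤ m ^ 2 := by linarith
  rcases le_total ((j : ℝ) / n) (1 / 2) with h' | h'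
  · left
    have := key (j / n) (by positivity) h' rfl
    rw [mul_div_cancel₀ _ hn0.ne'] at this
    exact_mod_cast this
  · right
    have := key (1 - j / n) (by rw [sub_nonneg, div_le_one hn0]; exact hjrn) (by linarith) (by
      rw [mul_sub, mul_one, Real.sin_pi_sub])
    rw [mul_sub, mul_div_cancel₀ _ hn0.ne', mul_one] at this
    have h2 : (numSectors s : ℝ) - m ≤ j := by linarith
    exact_mod_cast h2

/-- Indices are cyclic, so those near `l` lie in a window of length `2 m + 1` around `l` or around
one of its translates by the number of sectors. -/
theorem card_chordSq_le {φ : ℝ → ℝ} {s B : ℝ} {m : ℕ} (hs0 : 0 < s) (hs1 : s ≤ 1)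
    (hm : 8 * B ≤ m ^ 2) (l : Fin (numSectors s)) (S : Finset (Fin (numSectors s)))
    (hS : ∀ k ∈ S, chordSq (angle φ s k) (angle φ s l) ≤ B * s ^ 2) :
    S.card ≤ 3 * (2 * m + 1) := by
  classical
  set n : ℤ := (numSectors s : ℤ) with hn
  set I : ℤ → Finset ℤ := fun c => Finset.Icc (c - m) (c + m) with hI
  have hcard (c : ℤ) : (I c).card = 2 * m + 1 := by
    rw [hI, Int.card_Icc]; omega
  have hsub : S.image (fun k : Fin (numSectors s) => ((k : ℕ) : ℤ)) ⊆ I l ∪ (I (l + n) ∪ I (l - n)) := by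
    intro x hx
    obtain ⟨k, hk, rfl⟩ := Finset.mem_image.1 hx
    simp only [hI, Finset.mem_union, Finset.mem_Icc]
    have hk1 := k.2
    have hl1 := l.2
    rcases abs_sub_le_of_chordSq_le hs0 hs1 hm (hS k hk) with h | h
    · left; rw [abs_le] at h; constructor <;> omega
    · right
      rcases abs_cases ((k : ℤ) - l) with ⟨h1, -⟩ | ⟨h1, -⟩
      · left; constructor <;> omega
      · right; constructor <;> omega
  calc S.card = (S.image fun k : Fin (numSectors s) => ((k : ℕ) : ℤ)).card :=
        (Finset.card_image_of_injective _ fun x y hxy => by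
          apply Fin.ext; simpa using hxy).symm
    _ ≤ _ := Finset.card_le_card hsub
    _ ≤ (I l).card + ((I (l + n)).card + (I (l - n)).card) :=
        (Finset.card_union_le _ _).trans (by gcongr; exact Finset.card_union_le _ _)
    _ = 3 * (2 * m + 1) := by simp only [hcard]; ring

theorem pos_of_mem_dyadicScales {R s : ℝ} (hR : 1 ≤ R) (hs : s ∈ dyadicScales R) : 0 < s :=
  lt_of_lt_of_le (inv_pos.2 (Real.sqrt_pos.2 (by linarith))) hs.2.1

/-- For every frequency `ω` there is a scale `s` such that the difference boxes containing `ω`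
belong to boundedly many sectors of aperture `s`, and `ω` lies in a dilate of the dual plank of
each of these. -/
theorem exists_adapted_scale {K : ℝ} (hK : 1 ≤ K) :
    ∃ (N : ℕ) (C : ℝ), 0 < C ∧ ∀ R : ℝ, 1 ≤ R → ∀ φ : ℝ → ℝ,
      ∀ a : (s : dyadicScales R) → Fin (numSectors (√R)⁻¹) → Fin (numSectors s),
      (∀ (s : dyadicScales R) θ, (sector (√R)⁻¹ (angle φ (√R)⁻¹ θ) ∩
        sector s (angle φ s (a s θ))).Nonempty) →
      ∀ ω : E3, ∃ s : dyadicScales R,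
        (∀ θ, ω ∈ differenceBox K R (angle φ (√R)⁻¹ θ) →
          ω ∈ dualPlank C R s (angle φ s (a s θ))) ∧
        ∀ S : Finset (Fin (numSectors (√R)⁻¹)),
          (∀ θ ∈ S, ω ∈ differenceBox K R (angle φ (√R)⁻¹ θ)) → (S.image (a s)).card ≤ N := by
  -- `1536 + 192 K²` comes from two quasi-triangle inequalities: `2 · 256 + 2 (2 · 48 K² + 2 ·
  -- 256)`.
  obtain ⟨m, hm⟩ := exists_nat_ge (8 * (1536 + 192 * K ^ 2))
  have hm2 : 8 * (1536 + 192 * K ^ 2) ≤ (m : ℝ) ^ 2 :=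
    hm.trans (le_self_pow₀ (by nlinarith) two_ne_zero)
  -- The leading `2` counts the two sides of `ω`; `4 (2 K²)` is the bound `L` for `M s²` at the
  -- chosen scale.
  refine ⟨2 * (3 * (2 * m + 1)), 1000 * (K + 4 * (2 * K ^ 2)) ^ 2, by positivity, ?_⟩
  intro R hR φ a ha ω
  classical
  by_cases hex : ∃ θ, ω ∈ differenceBox K R (angle φ (√R)⁻¹ θ)
  swap
  · push Not at hex
    refine ⟨⟨1, ⟨0, by simp⟩, inv_le_one_of_one_le₀ (Real.one_le_sqrt.2 hR), le_rfl⟩,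
      fun θ hθ => absurd hθ (hex θ), fun S hS => ?_⟩
    rw [Finset.eq_empty_of_forall_notMem fun θ hθ => hex θ (hS θ hθ)]
    simp
  obtain ⟨θ₁, hθ₁⟩ := hex
  have hB : 1 ≤ 2 * K ^ 2 := by nlinarith
  obtain ⟨s, hs, hM1, hM2⟩ := exists_dyadicScale hR (one_le_invApertureSq R ω) hB
    (invApertureSq_le hK hR hθ₁)
  have hs0 : 0 < s := pos_of_mem_dyadicScales hR hs
  have hs1 : s ≤ 1 := hs.2.2
  set s' : dyadicScales R := ⟨s, hs⟩ with hs'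
  have hd (θ) : chordSq (angle φ (√R)⁻¹ θ) (angle φ s (a s' θ)) ≤ 256 * s ^ 2 :=
    chordSq_le_of_sector_inter (by positivity) hs.2.1 (ha s' θ)
  refine ⟨s', fun θ hθ => mem_dualPlank_of_chordSq_le hK (by linarith) hR hs0 hs1 hθ hM2 (hd θ),
    fun S hS => ?_⟩
  have hclose : ∀ θ ∈ S, ∀ θ' ∈ S,
      0 ≤ inner ℝ (tangentDir (angle φ (√R)⁻¹ θ)) ω *
        inner ℝ (tangentDir (angle φ (√R)⁻¹ θ')) ω →
      chordSq (angle φ s (a s' θ)) (angle φ s (a s' θ')) ≤ (1536 + 192 * K ^ 2) * s ^ 2 := by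
    intro θ hθ θ' hθ' hside
    have h0 := chordSq_mul_invApertureSq_le hK hR (hS θ hθ) (hS θ' hθ') hside
    have h1 : chordSq (angle φ (√R)⁻¹ θ) (angle φ (√R)⁻¹ θ') ≤ 48 * K ^ 2 * s ^ 2 := by
      calc _ ≤ chordSq (angle φ (√R)⁻¹ θ) (angle φ (√R)⁻¹ θ') * (invApertureSq R ω * s ^ 2) :=
            le_mul_of_one_le_right (chordSq_nonneg _ _) hM1
        _ ≤ _ := by rw [← mul_assoc]; gcongr
    have h2 := hd θ
    have h3 := hd θ'
    have h4 := chordSq_triangle (angle φ s (a s' θ)) (angle φ (√R)⁻¹ θ) (angle φ s (a s' θ'))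
    have h5 := chordSq_triangle (angle φ (√R)⁻¹ θ) (angle φ (√R)⁻¹ θ') (angle φ s (a s' θ'))
    rw [chordSq_comm (angle φ s (a s' θ)) (angle φ (√R)⁻¹ θ)] at h4
    linarith
  have hside : ∀ S' ⊆ S, (∀ θ ∈ S', ∀ θ' ∈ S',
      0 ≤ inner ℝ (tangentDir (angle φ (√R)⁻¹ θ)) ω *
        inner ℝ (tangentDir (angle φ (√R)⁻¹ θ')) ω) →
      (S'.image (a s')).card ≤ 3 * (2 * m + 1) := by
    intro S' hS' hpos
    rcases S'.eq_empty_or_nonempty with rfl | ⟨θ₀, hθ₀⟩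
    · simp
    refine card_chordSq_le (φ := φ) hs0 hs1 hm2 (a s' θ₀) _ fun k hk => ?_
    obtain ⟨θ, hθ, rfl⟩ := Finset.mem_image.1 hk
    exact hclose θ (hS' hθ) θ₀ (hS' hθ₀) (hpos θ hθ θ₀ hθ₀)
  -- The two clusters are separated by the sign of the tangential component of `ω`.
  rw [← Finset.filter_union_filter_not_eq
    (fun θ => 0 ≤ inner ℝ (tangentDir (angle φ (√R)⁻¹ θ)) ω) S, Finset.image_union, two_mul]
  refine (Finset.card_union_le _ _).trans (add_le_add ?_ ?_)
  · refine hside _ (Finset.filter_subset _ _) fun θ hθ θ' hθ' => ?_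
    exact mul_nonneg (Finset.mem_filter.1 hθ).2 (Finset.mem_filter.1 hθ').2
  · refine hside _ (Finset.filter_subset _ _) fun θ hθ θ' hθ' => ?_
    exact mul_nonneg_of_nonpos_of_nonpos (not_le.1 (Finset.mem_filter.1 hθ).2).le
      (not_le.1 (Finset.mem_filter.1 hθ').2).le

/-! ### Planks: duality, volume and boundedness -/

/-- The differences of two points of a dilated sector lie in the difference box. -/
theorem sub_mem_differenceBox {A R α : ℝ} (hA : 1 ≤ A) (hR : 1 ≤ R) {ξ η : E3}
    (hξ : ξ ∈ dilatedSector A (√R)⁻¹ α) (hη : η ∈ dilatedSector A (√R)⁻¹ α) :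
    ξ - η ∈ differenceBox (2 * A) R α := by
  obtain ⟨h1, h2, h3⟩ := hξ
  obtain ⟨h4, h5, h6⟩ := hη
  rw [inv_pow, Real.sq_sqrt (by linarith), ← div_eq_mul_inv] at h2 h5
  rw [← div_eq_mul_inv] at h3 h6
  rw [abs_le] at h1 h2 h3 h4 h5 h6
  refine ⟨?_, ?_, ?_⟩ <;> rw [inner_sub_right, abs_le] <;>
    (try rw [mul_div_assoc]) <;> constructor <;> linarith

/-- The phase `x · ω` is bounded for `x` in a small plank and `ω` in a dual plank. -/
theorem abs_inner_le_of_mem_plank {C c R s α : ℝ} (hR : 0 < R) (hs : 0 < s)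
    (hc : 0 ≤ c) {x ω : E3} (hx : x ∈ plank (c * R) s α) (hω : ω ∈ dualPlank C R s α) :
    |inner ℝ x ω| ≤ 2 * c * C := by
  obtain ⟨h1, h2, h3⟩ := hx
  obtain ⟨h4, h5, h6⟩ := hω
  -- `c`, `n`, `t` are orthogonal with squared lengths `2`, `2`, `1`; the weights `1/2 + 1/2 + 1`
  -- give the factor `2` of the conclusion.
  have e : inner ℝ x ω = inner ℝ (coreDir α) x * inner ℝ (coreDir α) ω / 2 +
      inner ℝ (normalDir α) x * inner ℝ (normalDir α) ω / 2 +
      inner ℝ (tangentDir α) x * inner ℝ (tangentDir α) ω := by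
    have : inner ℝ x ω = x 0 * ω 0 + x 1 * ω 1 + x 2 * ω 2 := by
      simp [PiLp.inner_apply, Fin.sum_univ_three]; ring
    simp only [this, inner_coreDir, inner_normalDir, inner_tangentDir]
    linear_combination (-(x 0 * ω 0 + x 1 * ω 1)) * Real.sin_sq_add_cos_sq α
  have p1 := mul_le_mul h1 h4 (abs_nonneg _) (by positivity)
  have p2 := mul_le_mul h2 h5 (abs_nonneg _) (by positivity)
  have p3 := mul_le_mul h3 h6 (abs_nonneg _) (by positivity)
  rw [← abs_mul] at p1 p2 p3
  rw [show c * R * s ^ 2 * (C / (R * s ^ 2)) = c * C by field_simp] at p1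
  rw [show c * R * (C / R) = c * C by field_simp] at p2
  rw [show c * R * s * (C / (R * s)) = c * C by field_simp] at p3
  rw [e]
  rw [abs_le] at *
  constructor <;> linarith

theorem isClosed_plank (ρ s α : ℝ) : IsClosed (plank ρ s α) := by
  unfold plank
  simp only [Set.ofPred_and]
  refine IsClosed.inter ?_ (IsClosed.inter ?_ ?_) <;>
    exact isClosed_le (by fun_prop) continuous_const

theorem plank_add_mem {ρ ρ' s α : ℝ} {x y : E3} (hx : x ∈ plank ρ s α) (hy : y ∈ plank ρ' s α) :
    x + y ∈ plank (ρ + ρ') s α := by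
  obtain ⟨h1, h2, h3⟩ := hx
  obtain ⟨h4, h5, h6⟩ := hy
  refine ⟨?_, ?_, ?_⟩ <;> rw [inner_add_right] <;> refine (abs_add_le _ _).trans ?_ <;> linarith

theorem neg_mem_plank {ρ s α : ℝ} {x : E3} (hx : x ∈ plank ρ s α) : -x ∈ plank ρ s α := by
  obtain ⟨h1, h2, h3⟩ := hx
  refine ⟨?_, ?_, ?_⟩ <;> rwa [inner_neg_right, abs_neg]

theorem plank_mono {ρ ρ' s α : ℝ} (hs : 0 ≤ s) (h : ρ ≤ ρ') : plank ρ s α ⊆ plank ρ' s α := by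
  rintro x ⟨h1, h2, h3⟩
  exact ⟨h1.trans (by gcongr), h2.trans h, h3.trans (by gcongr)⟩

theorem plank_mul {k : ℝ} (hk : 0 < k) (ρ s α : ℝ) : plank (k * ρ) s α = k • plank ρ s α := by
  ext x
  rw [Set.mem_smul_set_iff_inv_smul_mem₀ hk.ne']
  simp only [plank, Set.mem_ofPred_eq, inner_smul_right, abs_mul, abs_inv, abs_of_pos hk,
    inv_mul_le_iff₀ hk, mul_assoc]

theorem volume_plank_mul {k : ℝ} (hk : 0 < k) (ρ s α : ℝ) :
    volume (plank (k * ρ) s α) = ENNReal.ofReal (k ^ 3) * volume (plank ρ s α) := by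
  rw [plank_mul hk, Measure.addHaar_smul]
  simp [abs_of_pos hk]

theorem volume_plank_ne_zero {ρ s : ℝ} (hρ : 0 < ρ) (hs : 0 < s) (α : ℝ) :
    volume (plank ρ s α) ≠ 0 := by
  have ho : IsOpen {x : E3 | |inner ℝ (coreDir α) x| < ρ * s ^ 2 ∧ |inner ℝ (normalDir α) x| < ρ ∧
      |inner ℝ (tangentDir α) x| < ρ * s} := by
    simp only [Set.ofPred_and]
    refine IsOpen.inter ?_ (IsOpen.inter ?_ ?_) <;>
      exact isOpen_lt (by fun_prop) continuous_const
  have hpos := ho.measure_pos volume ⟨0, by simp; exact ⟨by positivity, by positivity, by positivity⟩⟩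
  refine (hpos.trans_le (measure_mono ?_)).ne'
  rintro x ⟨h1, h2, h3⟩
  exact ⟨h1.le, h2.le, h3.le⟩

theorem sq_norm_eq (α : ℝ) (x : E3) : ‖x‖ ^ 2 = inner ℝ (coreDir α) x ^ 2 / 2 +
    inner ℝ (normalDir α) x ^ 2 / 2 + inner ℝ (tangentDir α) x ^ 2 := by
  rw [EuclideanSpace.norm_sq_eq, Fin.sum_univ_three, inner_coreDir, inner_normalDir,
    inner_tangentDir]
  simp only [Real.norm_eq_abs, sq_abs]
  linear_combination (-(x 0 ^ 2 + x 1 ^ 2)) * Real.sin_sq_add_cos_sq α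

theorem isBounded_of_abs_inner_le {α a b c : ℝ} {S : Set E3}
    (h : ∀ x ∈ S, |inner ℝ (coreDir α) x| ≤ a ∧ |inner ℝ (normalDir α) x| ≤ b ∧
      |inner ℝ (tangentDir α) x| ≤ c) : Bornology.IsBounded S := by
  refine (Metric.isBounded_closedBall (x := (0 : E3)) (r := √(a ^ 2 + b ^ 2 + c ^ 2))).subset ?_
  intro x hx
  obtain ⟨h1, h2, h3⟩ := h x hx
  rw [mem_closedBall_zero_iff]
  refine Real.le_sqrt_of_sq_le ?_
  rw [sq_norm_eq α]
  have e1 := sq_le_sq' (abs_le.1 h1).1 (abs_le.1 h1).2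
  have e2 := sq_le_sq' (abs_le.1 h2).1 (abs_le.1 h2).2
  have e3 := sq_le_sq' (abs_le.1 h3).1 (abs_le.1 h3).2
  linarith [sq_nonneg (inner ℝ (coreDir α) x), sq_nonneg (inner ℝ (normalDir α) x)]

theorem volume_plank_ne_top (ρ s α : ℝ) : volume (plank ρ s α) ≠ ∞ :=
  (isBounded_of_abs_inner_le fun _ hx => hx).measure_lt_top.ne

theorem measurableSet_vadd_plank (v : E3) (ρ s α : ℝ) : MeasurableSet (v +ᵥ plank ρ s α) :=
  (isClosed_plank ρ s α).measurableSet.const_vadd v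

theorem mem_vadd_plank {v x : E3} {ρ s α : ℝ} : x ∈ v +ᵥ plank ρ s α ↔ x - v ∈ plank ρ s α := by
  rw [Set.mem_vadd_set_iff_neg_vadd_mem, vadd_eq_add, neg_add_eq_sub]

/-! ### Tilings and local averages -/

/-- The tiles have positive measure and are almost disjoint, which a σ-finite measure allows only
countably often. Countability is needed to exchange sums over tiles with integrals. -/
theorem countable_of_isTiling {R s α : ℝ} (hR : 0 < R) (hs : 0 < s) {T : Set E3}
    (hT : IsTiling (plank R s α) T) : Countable T := by
  have h := Measure.countable_meas_pos_of_disjoint_iUnion₀ (μ := volume)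
    (As := fun v : T => (v : E3) +ᵥ plank R s α)
    (fun v => (measurableSet_vadd_plank _ _ _ _).nullMeasurableSet)
    (fun v w hvw => hT.overlap v.2 w.2 fun h => hvw (Subtype.ext h))
  have hu : {i : T | 0 < volume ((i : E3) +ᵥ plank R s α)} = Set.univ := by
    ext v
    simp [measure_vadd, pos_iff_ne_zero, volume_plank_ne_zero hR hs α]
  rw [hu] at h
  exact Set.countable_univ_iff.1 h

/-- A point lies in boundedly many doubles of the tiles. -/
theorem card_doubled_tiles_le {R s α : ℝ} (hR : 0 < R) (hs : 0 < s) {T : Set E3}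
    (hT : IsTiling (plank R s α) T) (x : E3) (F : Finset T)
    (hF : ∀ v ∈ F, x ∈ (v : E3) +ᵥ plank (2 * R) s α) : F.card ≤ 27 := by
  have h0 := volume_plank_ne_zero hR hs α
  have htop := volume_plank_ne_top R s α
  have h1 : (F.card : ℝ≥0∞) * volume (plank R s α) ≤ 27 * volume (plank R s α) := by
    calc (F.card : ℝ≥0∞) * volume (plank R s α)
        = ∑ v ∈ F, volume ((v : E3) +ᵥ plank R s α) := by simp [measure_vadd]
      _ = volume (⋃ v ∈ F, ((v : E3) +ᵥ plank R s α)) := by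
          refine (measure_biUnion_finset₀ (fun v _ w _ hvw => ?_) fun v _ =>
            (measurableSet_vadd_plank _ _ _ _).nullMeasurableSet).symm
          exact hT.overlap v.2 w.2 fun h => hvw (Subtype.ext h)
      -- A tile whose double contains `x` lies in the threefold plank centred at `x`, of volume `27`
      -- times that of a tile.
      _ ≤ volume (x +ᵥ plank (3 * R) s α) := by
          refine measure_mono (Set.iUnion₂_subset fun v hv y hy => ?_)
          rw [mem_vadd_plank] at hy ⊢
          have := plank_add_mem hy (neg_mem_plank (mem_vadd_plank.1 (hF v hv)))
          rw [show y - ↑v + -(x - ↑v) = y - x by abel, show R + 2 * R = 3 * R by ring] at this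
          exact this
      _ = 27 * volume (plank R s α) := by
          rw [measure_vadd, volume_plank_mul (by norm_num)]; norm_num
  rw [ENNReal.mul_le_mul_iff_left h0 htop] at h1
  exact_mod_cast h1

/-- The square function of the averages of `g` over translates of a small plank is controlled by
the averages over the tiles. -/
theorem lintegral_average_sq_le {R s α c : ℝ} (hR : 0 < R) (hs : 0 < s) (hc0 : 0 < c) (hc1 : c ≤ 1)
    {T : Set E3} (hT : IsTiling (plank R s α) T) {g : E3 → ℝ≥0∞} (hg : Measurable g) :
    ∫⁻ x, ((volume (plank (c * R) s α))⁻¹ * ∫⁻ y in plank (c * R) s α, g (x - y)) ^ 2 ≤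
      ENNReal.ofReal (216 / c ^ 6) * ∑' v : T, (volume ((v : E3) +ᵥ plank R s α))⁻¹ *
        (∫⁻ x in (v : E3) +ᵥ plank R s α, g x) ^ 2 := by
  classical
  have hcount := countable_of_isTiling hR hs hT
  set W := volume (plank R s α) with hW
  have hW0 : W ≠ 0 := volume_plank_ne_zero hR hs α
  have hWtop : W ≠ ∞ := volume_plank_ne_top R s α
  set b : T → ℝ≥0∞ := fun v => ∫⁻ x in (v : E3) +ᵥ plank R s α, g x with hb
  set D : T → Set E3 := fun v => (v : E3) +ᵥ plank (2 * R) s α with hD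
  have hDm (v : T) : MeasurableSet (D v) := measurableSet_vadd_plank _ _ _ _
  have hVm : MeasurableSet (plank (c * R) s α) := (isClosed_plank _ _ _).measurableSet
  -- the average at `x` is controlled by the tiles near `x`
  have hI (x : E3) : ∫⁻ y in plank (c * R) s α, g (x - y) ≤
      ∑' v : T, (D v).indicator (fun _ => b v) x := by
    calc ∫⁻ y in plank (c * R) s α, g (x - y)
        = ∫⁻ y, (plank (c * R) s α).indicator (fun y => g (x - y)) y := by
          rw [lintegral_indicator hVm]
      _ = ∫⁻ z, (plank (c * R) s α).indicator (fun y => g (x - y)) (x - z) :=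
          (lintegral_sub_left_eq_self _ x).symm
      _ ≤ ∫⁻ z, ∑' v : T, ((v : E3) +ᵥ plank R s α).indicator
            (fun z => (D v).indicator (fun _ => g z) x) z := by
          refine lintegral_mono fun z => ?_
          by_cases hz : x - z ∈ plank (c * R) s α
          · have : z ∈ ⋃ v ∈ T, (v +ᵥ plank R s α) := by rw [hT.cover]; trivial
            obtain ⟨v, hv, hzv⟩ := Set.mem_iUnion₂.1 this
            -- As `c ≤ 1`, the small plank moves a point of a tile no further than into the double
            -- of that tile.
            have hx : x ∈ D ⟨v, hv⟩ := by
              rw [hD, mem_vadd_plank]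
              rw [mem_vadd_plank] at hzv
              have := plank_add_mem (plank_mono hs.le (by nlinarith : c * R ≤ R) hz) hzv
              rwa [show x - z + (z - v) = x - v by abel, ← two_mul] at this
            refine le_trans ?_ (ENNReal.le_tsum (⟨v, hv⟩ : T))
            simp [hz, hzv, hx]
          · simp [hz]
      _ = ∑' v : T, ∫⁻ z, ((v : E3) +ᵥ plank R s α).indicator
            (fun z => (D v).indicator (fun _ => g z) x) z := by
          refine lintegral_tsum fun v => (Measurable.indicator ?_
            (measurableSet_vadd_plank _ _ _ _)).aemeasurable
          by_cases hx : x ∈ D v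
          · simpa [hx] using hg
          · simp [hx]
      _ = _ := by
          refine tsum_congr fun v => ?_
          rw [lintegral_indicator (measurableSet_vadd_plank _ _ _ _)]
          by_cases hx : x ∈ D v <;> simp [hx, hb]
  have hsq (x : E3) : (∑' v : T, (D v).indicator (fun _ => b v) x) ^ 2 ≤
      27 * ∑' v : T, (D v).indicator (fun _ => b v ^ 2) x := by
    refine le_of_tendsto' (((ENNReal.continuous_pow 2).tendsto _).comp
      ENNReal.summable.hasSum) fun F => ?_
    simp only [Function.comp]
    set F' := F.filter fun v => x ∈ D v with hF'
    have e (w : T → ℝ≥0∞) : ∑ v ∈ F, (D v).indicator (fun _ => w v) x = ∑ v ∈ F', w v := by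
      rw [hF', Finset.sum_filter]
      exact Finset.sum_congr rfl fun v _ => by simp [Set.indicator_apply]
    have hcs := ENNReal.rpow_sum_le_const_mul_sum_rpow F' b (p := 2) (by norm_num)
    norm_num at hcs
    have hcard : (F'.card : ℝ≥0∞) ≤ 27 := by
      exact_mod_cast card_doubled_tiles_le hR hs hT x F' fun v hv => (Finset.mem_filter.1 hv).2
    rw [e]
    calc (∑ v ∈ F', b v) ^ 2 ≤ F'.card * ∑ v ∈ F', b v ^ 2 := hcs
      _ ≤ 27 * ∑ v ∈ F', b v ^ 2 := by gcongr
      _ = 27 * ∑ v ∈ F, (D v).indicator (fun _ => b v ^ 2) x := by rw [e]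
      _ ≤ _ := by gcongr; exact ENNReal.sum_le_tsum F
  have hV : volume (plank (c * R) s α) = ENNReal.ofReal (c ^ 3) * W := volume_plank_mul hc0 R s α
  set Q := volume (plank (c * R) s α) with hQ
  have hint : ∫⁻ x, ∑' v : T, (D v).indicator (fun _ => b v ^ 2) x = 8 * W * ∑' v : T, b v ^ 2 := by
    rw [lintegral_tsum fun v => (measurable_const.indicator (hDm v)).aemeasurable,
      ← ENNReal.tsum_mul_left]
    refine tsum_congr fun v => ?_
    rw [lintegral_indicator_const (hDm v), hD, measure_vadd, volume_plank_mul two_pos, mul_comm]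
    norm_num [hW]
  have hc3 : ENNReal.ofReal (c ^ 3) ≠ 0 := by simpa using pow_pos hc0 3
  calc ∫⁻ x, (Q⁻¹ * ∫⁻ y in plank (c * R) s α, g (x - y)) ^ 2
      ≤ ∫⁻ x, (Q⁻¹ ^ 2 * 27) * ∑' v : T, (D v).indicator (fun _ => b v ^ 2) x := by
        refine lintegral_mono fun x => ?_
        rw [mul_pow, mul_assoc]
        gcongr
        exact (pow_le_pow_left₀ (zero_le) (hI x) 2).trans (hsq x)
    _ = (Q⁻¹ ^ 2 * 27) * (8 * W * ∑' v : T, b v ^ 2) := by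
        rw [lintegral_const_mul, hint]
        exact Measurable.tsum fun v => measurable_const.indicator (hDm v)
    -- `216 = 27 · 8`: the overlap of the doubled tiles times their relative volume. The factor
    -- `c⁻⁶` is the squared normalization of the averages.
    _ = ENNReal.ofReal (216 / c ^ 6) * ∑' v : T, W⁻¹ * b v ^ 2 := by
        rw [ENNReal.tsum_mul_left, hV, ENNReal.mul_inv (Or.inl hc3) (Or.inl ENNReal.ofReal_ne_top),
          ← ENNReal.ofReal_inv_of_pos (pow_pos hc0 3)]
        have e1 : ENNReal.ofReal (216 / c ^ 6) = 216 * ENNReal.ofReal ((c ^ 3)⁻¹) ^ 2 := by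
          rw [← ENNReal.ofReal_pow (by positivity), show (216 : ℝ≥0∞) = ENNReal.ofReal 216 by simp,
            ← ENNReal.ofReal_mul (by norm_num)]
          congr 1
          field_simp
        rw [e1]
        have e2 : W⁻¹ * W = 1 := ENNReal.inv_mul_cancel hW0 hWtop
        calc _ = 216 * ENNReal.ofReal ((c ^ 3)⁻¹) ^ 2 * (W⁻¹ * W) * (W⁻¹ * ∑' v : T, b v ^ 2) := by
              ring
          _ = _ := by rw [e2]; ring
    _ = _ := by simp only [measure_vadd, hb, hW]

/-! ### Fourier inversion, Plancherel and the transform of `|f|²` -/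

theorem continuous_fourier {f : E3 → ℂ} (hf : Integrable f) : Continuous (𝓕 f) :=
  VectorFourier.fourierIntegral_continuous Real.continuous_fourierChar
    (by exact continuous_inner) hf

theorem continuous_fourierInv {f : E3 → ℂ} (hf : Integrable f) : Continuous (𝓕⁻ f) := by
  have : 𝓕⁻ f = fun x => 𝓕 f (-x) := funext fun x => Real.fourierInv_eq_fourier_neg f x
  rw [this]
  exact (continuous_fourier hf).comp continuous_neg

theorem norm_fourier_le (f : E3 → ℂ) (ω : E3) : ‖𝓕 f ω‖ ≤ ∫ x, ‖f x‖ :=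
  VectorFourier.norm_fourierIntegral_le_integral_norm _ _ _ _ _

theorem norm_fourierInv_le (f : E3 → ℂ) (x : E3) : ‖𝓕⁻ f x‖ ≤ ∫ ξ, ‖f ξ‖ := by
  rw [Real.fourierInv_eq_fourier_neg]
  exact norm_fourier_le f (-x)

theorem integral_fourier_mul {f g : E3 → ℂ} (hf : Integrable f) (hg : Integrable g) :
    ∫ ξ, 𝓕 f ξ * g ξ = ∫ x, f x * 𝓕 g x := by
  have := VectorFourier.integral_fourierIntegral_smul_eq_flip (L := innerₗ E3) (μ := volume)
    (ν := volume) Real.continuous_fourierChar (by exact continuous_inner) hf hg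
  rwa [flip_innerₗ] at this

theorem integral_fourierInv_mul {f g : E3 → ℂ} (hf : Integrable f) (hg : Integrable g) :
    ∫ ξ, 𝓕⁻ f ξ * g ξ = ∫ x, f x * 𝓕⁻ g x := by
  simp only [Real.fourierInv_eq_fourier_neg]
  rw [← integral_neg_eq_self (fun ξ => 𝓕 f (-ξ) * g ξ)]
  simp only [neg_neg]
  rw [integral_fourier_mul hf hg.comp_neg]
  congr 1
  ext x
  rw [← Real.fourierInv_eq_fourier_neg, Real.fourierInv_eq_fourier_comp_neg]

theorem star_fourierInv (f : E3 → ℂ) (x : E3) :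
    star (𝓕⁻ f x) = 𝓕 (fun ξ => star (f ξ)) x := by
  rw [Real.fourierInv_eq, Real.fourier_eq]
  refine (integral_conj (f := fun v => Real.fourierChar (inner ℝ v x) • f v)).symm.trans ?_
  congr 1
  ext v
  rw [Circle.smul_def, Circle.smul_def, smul_eq_mul, smul_eq_mul, map_mul, AddChar.map_neg_eq_inv,
    Circle.coe_inv_eq_conj]
  rfl

/-- Fourier inversion almost everywhere. -/
theorem ae_eq_fourierInv_fourier {f : E3 → ℂ} (hf : Integrable f) (hf' : Integrable (𝓕 f)) :
    f =ᵐ[volume] 𝓕⁻ (𝓕 f) := by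
  -- Both sides are tested against smooth compactly supported functions; the transforms are moved
  -- onto the test function, where Schwartz inversion applies.
  refine ae_eq_of_integral_contDiff_smul_eq hf.locallyIntegrable
    (continuous_fourierInv hf').locallyIntegrable fun g hg hgc => ?_
  have hgs : HasCompactSupport fun x => (g x : ℂ) := hgc.comp_left (g := Complex.ofReal) rfl
  set G : 𝓢(E3, ℂ) := hgs.toSchwartzMap (Complex.ofRealCLM.contDiff.comp hg) with hG
  have hGg (x) : G x = g x := rfl
  have e1 : ∀ v : E3 → ℂ, ∫ x, g x • v x = ∫ x, G x * v x := fun v => by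
    congr 1
  rw [e1, e1]
  have e2 : ∫ x, G x * 𝓕⁻ (𝓕 f) x = ∫ x, 𝓕⁻ (⇑G) x * 𝓕 f x :=
    (integral_fourierInv_mul G.integrable hf').symm
  have e3 : 𝓕 (𝓕⁻ (⇑G)) = G := by
    rw [← SchwartzMap.fourierInv_coe, ← SchwartzMap.fourier_coe, FourierTransform.fourier_fourierInv_eq]
  have hGi : Integrable (𝓕⁻ (⇑G)) := by
    rw [← SchwartzMap.fourierInv_coe]; exact (𝓕⁻ G).integrable
  rw [e2, ← integral_fourier_mul hGi hf, e3]

/-- Plancherel's theorem for continuous integrable functions with integrable transform. -/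
theorem lintegral_enorm_sq_fourier {f : E3 → ℂ} (hc : Continuous f) (hf : Integrable f)
    (hf' : Integrable (𝓕 f)) : ∫⁻ ξ, ‖𝓕 f ξ‖ₑ ^ 2 = ∫⁻ x, ‖f x‖ₑ ^ 2 := by
  have hinv : 𝓕⁻ (𝓕 f) = f := hc.fourierInv_fourier_eq hf hf'
  have hb (x : E3) : ‖f x‖ ≤ ∫ ξ, ‖𝓕 f ξ‖ := by
    conv_lhs => rw [← hinv]
    exact norm_fourierInv_le _ x
  -- The multiplication formula with second factor `star (𝓕 f)`, whose transform is `star f` by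
  -- inversion.
  have key : ∫ ξ, 𝓕 f ξ * star (𝓕 f ξ) = ∫ x, f x * star (f x) := by
    have hs : Integrable fun ξ => star (𝓕 f ξ) := Complex.conjCLE.toContinuousLinearMap.integrable_comp hf'
    rw [integral_fourier_mul hf hs]
    congr 1
    ext x
    rw [← star_fourierInv, hinv]
  have conv : ∀ u : E3 → ℂ, Continuous u → Integrable u → (∃ B, ∀ x, ‖u x‖ ≤ B) →
      ∫⁻ x, ‖u x‖ₑ ^ 2 = ENNReal.ofReal (∫ x, u x * star (u x)).re := by
    rintro u hu hui ⟨B, hB⟩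
    have e (x) : u x * star (u x) = ((‖u x‖ ^ 2 : ℝ) : ℂ) := by
      rw [← Complex.normSq_eq_norm_sq, ← Complex.mul_conj]; rfl
    have hi : Integrable fun x => ‖u x‖ ^ 2 := by
      simp only [sq]
      exact hui.norm.bdd_mul hu.norm.aestronglyMeasurable (Filter.Eventually.of_forall fun x => by
        rw [norm_norm]; exact hB x)
    simp only [e]
    rw [integral_complex_ofReal, Complex.ofReal_re,
      ofReal_integral_eq_lintegral_ofReal hi (Filter.Eventually.of_forall fun x => by positivity)]
    refine lintegral_congr fun x => ?_
    rw [ENNReal.ofReal_pow (norm_nonneg _), ofReal_norm]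
  rw [conv _ (continuous_fourier hf) hf' ⟨_, norm_fourier_le f⟩, conv _ hc hf ⟨_, hb⟩, key]

theorem fourier_mul_char (f : E3 → ℂ) (ω ξ : E3) :
    𝓕 (fun x => (Real.fourierChar (-inner ℝ x ω) : ℂ) * f x) ξ = 𝓕 f (ξ + ω) := by
  rw [Real.fourier_eq, Real.fourier_eq]
  congr 1
  ext x
  rw [inner_add_right, neg_add, AddChar.map_add_eq_mul, mul_smul]
  rfl

/-- The Fourier transform of `|f|²` is supported in the difference set of the Fourier support. -/
theorem fourier_norm_sq_eq_zero {f : E3 → ℂ} (hc : Continuous f) (hf : Integrable f)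
    (hf' : Integrable (𝓕 f)) {S : Set E3} (hS : ∀ ξ ∉ S, 𝓕 f ξ = 0) {ω : E3}
    (hω : ∀ ξ ∈ S, ∀ η ∈ S, ω ≠ ξ - η) : 𝓕 (fun x => ((‖f x‖ ^ 2 : ℝ) : ℂ)) ω = 0 := by
  have hinv : 𝓕⁻ (𝓕 f) = f := hc.fourierInv_fourier_eq hf hf'
  have hs : Integrable fun ξ => star (𝓕 f ξ) := Complex.conjCLE.toContinuousLinearMap.integrable_comp hf'
  have hm : Integrable fun x => (Real.fourierChar (-inner ℝ x ω) : ℂ) * f x :=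
    (Real.fourierIntegral_convergent_iff ω).2 hf
  -- Writing `star f` as a transform turns the integral into the autocorrelation `∫ star (𝓕 f ξ) 𝓕 f
  -- (ξ + ω)`, whose integrand vanishes unless `ω` is a difference of points of `S`.
  have e : 𝓕 (fun x => ((‖f x‖ ^ 2 : ℝ) : ℂ)) ω =
      ∫ x, 𝓕 (fun ξ => star (𝓕 f ξ)) x * ((Real.fourierChar (-inner ℝ x ω) : ℂ) * f x) := by
    rw [Real.fourier_eq]
    congr 1
    ext x
    rw [← star_fourierInv, hinv, ← Complex.normSq_eq_norm_sq, ← Complex.mul_conj, Circle.smul_def,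
      smul_eq_mul]
    simp only [RCLike.star_def]
    ring
  rw [e, integral_fourier_mul hs hm]
  refine integral_eq_zero_of_ae (Filter.Eventually.of_forall fun ξ => ?_)
  simp only [fourier_mul_char, Pi.zero_apply]
  by_cases h1 : ξ ∈ S
  · rw [hS (ξ + ω) fun h2 => hω _ h2 _ h1 (by abel), mul_zero]
  · rw [hS ξ h1, star_zero, zero_mul]

theorem integrable_of_continuous_of_isBounded {f : E3 → ℂ} (hf : Continuous f) {S : Set E3}
    (hS : Bornology.IsBounded S) (h : ∀ x ∉ S, f x = 0) : Integrable f := by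
  refine hf.integrable_of_hasCompactSupport
    (HasCompactSupport.of_support_subset_isCompact hS.isCompact_closure ?_)
  intro x hx
  by_contra hxS
  exact hx (h x fun h' => hxS (subset_closure h'))

/-! ### Plank averages and the estimate on one dual plank -/

/-- The normalized indicator function of a plank. -/
def plankAverage (ρ s α : ℝ) : E3 → ℂ :=
  (plank ρ s α).indicator fun _ => ((volume.real (plank ρ s α))⁻¹ : ℂ)

theorem integrable_plankAverage (ρ s α : ℝ) : Integrable (plankAverage ρ s α) :=
  (integrable_indicator_iff (isClosed_plank ρ s α).measurableSet).2
    (integrableOn_const (volume_plank_ne_top ρ s α))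

/-- The Fourier transform of a plank average is bounded below on a dual plank. -/
theorem half_le_norm_fourier_plankAverage {C c R s α : ℝ} (hR : 0 < R) (hs : 0 < s) (hc : 0 < c)
    (hcC : 12 * c * C ≤ 1) {ω : E3} (hω : ω ∈ dualPlank C R s α) :
    1 / 2 ≤ ‖𝓕 (plankAverage (c * R) s α) ω‖ := by
  set V := plank (c * R) s α with hV
  have hVm : MeasurableSet V := (isClosed_plank _ _ _).measurableSet
  have hV0 : 0 < volume.real V :=
    ENNReal.toReal_pos (volume_plank_ne_zero (by positivity) hs α) (volume_plank_ne_top _ _ _)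
  have hint : Integrable fun x => Real.fourierChar (-inner ℝ x ω) • plankAverage (c * R) s α x :=
    (Real.fourierIntegral_convergent_iff ω).2 (integrable_plankAverage _ _ _)
  refine le_trans ?_ (Complex.re_le_norm _)
  rw [Real.fourier_eq]
  have hre : (∫ x, Real.fourierChar (-inner ℝ x ω) • plankAverage (c * R) s α x).re =
      ∫ x, (Real.fourierChar (-inner ℝ x ω) • plankAverage (c * R) s α x).re :=
    (integral_re hint).symm
  rw [hre]
  have hhalf : ∫ x, V.indicator (fun _ => (volume.real V)⁻¹ * (1 / 2)) x = 1 / 2 := by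
    rw [integral_indicator hVm, setIntegral_const, smul_eq_mul]
    field_simp
  rw [← hhalf]
  refine integral_mono ((integrable_indicator_iff hVm).2
    (integrableOn_const (volume_plank_ne_top _ _ _))) hint.re fun x => ?_
  by_cases hx : x ∈ V
  · have hph : |inner ℝ x ω| ≤ 1 / 6 :=
      (abs_inner_le_of_mem_plank hR hs hc.le hx hω).trans (by linarith)
    have hcos : 1 / 2 ≤ Real.cos (2 * Real.pi * -inner ℝ x ω) := by
      rw [← Real.cos_abs, abs_mul, abs_neg, abs_of_pos Real.two_pi_pos, ← Real.cos_pi_div_three]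
      refine Real.cos_le_cos_of_nonneg_of_le_pi (by positivity) (by linarith [Real.pi_pos]) ?_
      nlinarith [Real.pi_pos]
    have e : (Real.fourierChar (-inner ℝ x ω) • plankAverage (c * R) s α x).re =
        (volume.real V)⁻¹ * Real.cos (2 * Real.pi * -inner ℝ x ω) := by
      rw [plankAverage, Set.indicator_of_mem hx, Circle.smul_def, Real.fourierChar_apply,
        smul_eq_mul, ← Complex.ofReal_inv, Complex.re_mul_ofReal, Complex.exp_ofReal_mul_I_re,
        mul_comm]
    simp only [Set.indicator_of_mem hx, e]
    gcongr
  · simp [hx, plankAverage, ← hV]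

/-- The part of `∫ |ĝ|²` over a dual plank is controlled by the averages of `g` over the tiles. -/
theorem setLIntegral_fourier_dualPlank_le {C c R s α : ℝ} (hR : 0 < R) (hs : 0 < s) (hc : 0 < c)
    (hc1 : c ≤ 1) (hcC : 12 * c * C ≤ 1) {T : Set E3} (hT : IsTiling (plank R s α) T)
    {g : E3 → ℝ} (hgc : Continuous g) (hgi : Integrable g)
    (hgb : BddAbove (Set.range fun x => ‖(g x : ℂ)‖))
    {S : Set E3} (hS : Bornology.IsBounded S) (hgS : ∀ ω ∉ S, 𝓕 (fun x => (g x : ℂ)) ω = 0) :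
    ∫⁻ ω, (dualPlank C R s α).indicator (fun ω => ‖𝓕 (fun x => (g x : ℂ)) ω‖ₑ ^ 2) ω ≤
      ENNReal.ofReal (864 / c ^ 6) * ∑' v : T, (volume ((v : E3) +ᵥ plank R s α))⁻¹ *
        (∫⁻ x in (v : E3) +ᵥ plank R s α, ‖g x‖ₑ) ^ 2 := by
  set h := plankAverage (c * R) s α with hh
  have hhi : Integrable h := integrable_plankAverage _ _ _
  set G : E3 → ℂ := fun x => (g x : ℂ) with hG
  have hGc : Continuous G := Complex.continuous_ofReal.comp hgc
  have hGi : Integrable G := hgi.ofReal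
  set u : E3 → ℂ := convolution h G (ContinuousLinearMap.mul ℂ ℂ) volume with hu
  have hui : Integrable u := hhi.integrable_convolution _ hGi
  have huc : Continuous u := hgb.continuous_convolution_right_of_integrable _ hhi hGc
  have huF (ω : E3) : 𝓕 u ω = 𝓕 h ω * 𝓕 G ω := Real.fourier_mul_convolution_eq hhi hGi ω
  -- Bounded frequency support makes the continuous function `𝓕 u` integrable, as Plancherel
  -- requires here.
  have huFi : Integrable (𝓕 u) :=
    integrable_of_continuous_of_isBounded (continuous_fourier hui) hS fun ω hω => by
      rw [huF, hgS ω hω, mul_zero]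
  have hVm : MeasurableSet (plank (c * R) s α) := (isClosed_plank _ _ _).measurableSet
  have hV0 := volume_plank_ne_zero (mul_pos hc hR) hs α
  have h1 (ω : E3) : (dualPlank C R s α).indicator (fun ω => ‖𝓕 G ω‖ₑ ^ 2) ω ≤
      4 * ‖𝓕 u ω‖ₑ ^ 2 := by
    by_cases hω : ω ∈ dualPlank C R s α
    · have h2 := half_le_norm_fourier_plankAverage hR hs hc hcC hω
      rw [Set.indicator_of_mem hω, huF, enorm_mul]
      have h3 : 1 ≤ 2 * ‖𝓕 h ω‖ₑ := by
        have h5 := ENNReal.ofReal_le_ofReal (show 1 ≤ 2 * ‖𝓕 h ω‖ by linarith)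
        rwa [ENNReal.ofReal_one, ENNReal.ofReal_mul zero_le_two, ofReal_norm,
          ENNReal.ofReal_ofNat] at h5
      calc ‖𝓕 G ω‖ₑ ^ 2 ≤ (2 * ‖𝓕 h ω‖ₑ * ‖𝓕 G ω‖ₑ) ^ 2 := by
            gcongr
            exact le_mul_of_one_le_left (zero_le) h3
        _ = _ := by ring
    · rw [Set.indicator_of_notMem hω]; exact zero_le
  have h4 (x : E3) : ‖u x‖ₑ ≤ (volume (plank (c * R) s α))⁻¹ *
      ∫⁻ y in plank (c * R) s α, ‖g (x - y)‖ₑ := by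
    refine (enorm_integral_le_lintegral_enorm _).trans ?_
    rw [← lintegral_const_mul' _ _ (ENNReal.inv_ne_top.2 hV0), ← lintegral_indicator hVm]
    refine lintegral_mono fun y => ?_
    by_cases hy : y ∈ plank (c * R) s α
    · simp only [hh, plankAverage, Set.indicator_of_mem hy, ContinuousLinearMap.mul_apply',
        enorm_mul, hG]
      rw [← Complex.ofReal_inv, ← ofReal_norm, ← ofReal_norm, ← ofReal_norm, Complex.norm_real,
        Complex.norm_real, norm_inv, ENNReal.ofReal_inv_of_pos (by
          rw [norm_pos_iff]
          exact (ENNReal.toReal_pos hV0 (volume_plank_ne_top _ _ _)).ne'),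
        Real.norm_of_nonneg measureReal_nonneg, ofReal_measureReal (volume_plank_ne_top _ _ _)]
    · simp [hh, plankAverage, hy]
  calc _ ≤ ∫⁻ ω, 4 * ‖𝓕 u ω‖ₑ ^ 2 := lintegral_mono h1
    _ = 4 * ∫⁻ x, ‖u x‖ₑ ^ 2 := by
        rw [lintegral_const_mul' _ _ (by simp), lintegral_enorm_sq_fourier huc hui huFi]
    _ ≤ 4 * ∫⁻ x, ((volume (plank (c * R) s α))⁻¹ *
          ∫⁻ y in plank (c * R) s α, ‖g (x - y)‖ₑ) ^ 2 := by
        gcongr with x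
        exact h4 x
    _ ≤ 4 * (ENNReal.ofReal (216 / c ^ 6) * ∑' v : T, (volume ((v : E3) +ᵥ plank R s α))⁻¹ *
        (∫⁻ x in (v : E3) +ᵥ plank R s α, ‖g x‖ₑ) ^ 2) :=
        mul_le_mul_right (lintegral_average_sq_le (g := fun x => ‖g x‖ₑ) hR hs hc hc1 hT
          hgc.enorm.measurable) _
    _ = _ := by
        rw [← mul_assoc]
        congr 1
        rw [show (4 : ℝ≥0∞) = ENNReal.ofReal 4 by simp, ← ENNReal.ofReal_mul (by norm_num)]
        congr 1
        ring

/-! ### Summation over scales and sectors for continuous integrable functions -/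

theorem isBounded_dilatedSector (A s α : ℝ) : Bornology.IsBounded (dilatedSector A s α) := by
  refine isBounded_of_abs_inner_le (α := α) (a := A / 2 + 3 / 2) fun x hx => ⟨?_, hx.2.1, hx.2.2⟩
  have := abs_le.1 hx.1
  rw [abs_le]
  constructor <;> linarith

theorem isBounded_differenceBox (K R α : ℝ) : Bornology.IsBounded (differenceBox K R α) :=
  isBounded_of_abs_inner_le fun _ hx => hx

theorem isClosed_dualPlank (C R s α : ℝ) : IsClosed (dualPlank C R s α) := by
  unfold dualPlank
  simp only [Set.ofPred_and]
  refine IsClosed.inter ?_ (IsClosed.inter ?_ ?_) <;>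
    exact isClosed_le (by fun_prop) continuous_const

theorem countable_dyadicScales (R : ℝ) : Countable (dyadicScales R) :=
  ((Set.countable_range fun m : ℤ => (2 : ℝ) ^ m).mono (by
    rintro s ⟨⟨m, rfl⟩, -⟩
    exact ⟨m, rfl⟩)).to_subtype

theorem sqSum_nonneg {ι : Type} (B : Finset ι) (f : ι → E3 → ℂ) (x : E3) : 0 ≤ sqSum B f x :=
  Finset.sum_nonneg fun _ _ => by positivity

theorem enorm_sum_sq_le {ι : Type} (S : Finset ι) (z : ι → ℂ) :
    ‖∑ i ∈ S, z i‖ₑ ^ 2 ≤ S.card * ∑ i ∈ S, ‖z i‖ₑ ^ 2 := by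
  have h := ENNReal.rpow_sum_le_const_mul_sum_rpow S (fun i => ‖z i‖ₑ) (p := 2) (by norm_num)
  norm_num at h
  exact (pow_le_pow_left₀ zero_le (enorm_sum_le _ _) 2).trans h

/-- Cauchy-Schwarz over the fibers of `a`, few of which contribute. -/
theorem enorm_sum_sq_le_of_fibers {ι κ : Type} [Fintype ι] [Fintype κ] [DecidableEq κ]
    (a : ι → κ) (z : ι → ℂ) {N : ℕ} {D : κ → Set E3} {ω : E3}
    (hD : ∀ θ, z θ ≠ 0 → ω ∈ D (a θ))
    (hN : ∀ S : Finset ι, (∀ θ ∈ S, z θ ≠ 0) → (S.image a).card ≤ N) :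
    ‖∑ θ, z θ‖ₑ ^ 2 ≤ N * ∑ τ, (D τ).indicator
      (fun _ => ‖∑ θ with a θ = τ, z θ‖ₑ ^ 2) ω := by
  classical
  set S := Finset.univ.filter fun θ => z θ ≠ 0 with hS
  have hmem : ∀ θ ∈ S, z θ ≠ 0 := fun θ hθ => (Finset.mem_filter.1 hθ).2
  -- Fibers without a nonzero term drop out before Cauchy-Schwarz, so the loss is the number of
  -- active fibers only.
  have hsum : ∑ θ, z θ = ∑ τ ∈ S.image a, ∑ θ with a θ = τ, z θ := by
    rw [← Finset.sum_fiberwise Finset.univ a z]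
    refine (Finset.sum_subset (Finset.subset_univ _) fun τ _ hτ => ?_).symm
    refine Finset.sum_eq_zero fun θ hθ => ?_
    by_contra h
    exact hτ (Finset.mem_image.2 ⟨θ, Finset.mem_filter.2 ⟨Finset.mem_univ _, h⟩,
      (Finset.mem_filter.1 hθ).2⟩)
  rw [hsum]
  refine (enorm_sum_sq_le _ _).trans (mul_le_mul' (by exact_mod_cast hN S hmem) ?_)
  refine le_trans (Finset.sum_le_sum fun τ hτ => ?_)
    (Finset.sum_le_sum_of_subset (Finset.subset_univ (S.image a)))
  obtain ⟨θ, hθ, rfl⟩ := Finset.mem_image.1 hτ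
  rw [Set.indicator_of_mem (hD θ (hmem θ hθ))]

/-- The sum over all scales, sectors and tiles of `|U|⁻¹ (∫_U ∑_{θ ∈ A(τ)} |f_θ|²)²`. -/
def tileSum (R : ℝ) (φ : ℝ → ℝ)
    (a : (s : dyadicScales R) → Fin (numSectors (√R)⁻¹) → Fin (numSectors s))
    (T : (s : dyadicScales R) → Fin (numSectors s) → Set E3)
    (f : Fin (numSectors (√R)⁻¹) → E3 → ℂ) : ℝ≥0∞ :=
  ∑' s : dyadicScales R, ∑ τ : Fin (numSectors s), ∑' v : T s τ,
    (volume ((v : E3) +ᵥ plank R s (angle φ s τ)))⁻¹ *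
      (∫⁻ x in (v : E3) +ᵥ plank R s (angle φ s τ),
        ‖sqSum (Finset.univ.filter fun θ => a s θ = τ) f x‖ₑ) ^ 2

theorem eLpNorm_squareFn_pow {ι : Type} (B : Finset ι) (f : ι → E3 → ℂ) {U : Set E3}
    (hU : MeasurableSet U) :
    eLpNorm (squareFn B f U) 2 volume ^ 4 = (∫⁻ x in U, ‖sqSum B f x‖ₑ) ^ 2 := by
  have h : eLpNorm (squareFn B f U) 2 volume ^ 2 = ∫⁻ x in U, ‖sqSum B f x‖ₑ := by
    have h1 := eLpNorm_nnreal_pow_eq_lintegral (f := squareFn B f U) (μ := volume) (p := 2)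
      two_ne_zero
    norm_num at h1
    rw [h1, ← lintegral_indicator hU]
    refine lintegral_congr fun x => ?_
    by_cases hx : x ∈ U
    · simp only [squareFn, Set.indicator_of_mem hx]
      rw [← enorm_pow, Real.sq_sqrt (sqSum_nonneg B f x)]
    · simp [squareFn, hx]
  rw [← h, ← pow_mul]

/-- The estimate for continuous integrable functions with Fourier support in the dilated sectors. -/
theorem exists_lintegral_sqSum_le_tileSum_of_continuous {A : ℝ} (hA : 1 ≤ A) :
    ∃ C : ℝ≥0, ∀ R : ℝ, 1 ≤ R → ∀ φ : ℝ → ℝ,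
      ∀ a : (s : dyadicScales R) → Fin (numSectors (√R)⁻¹) → Fin (numSectors s),
      (∀ (s : dyadicScales R) θ, (sector (√R)⁻¹ (angle φ (√R)⁻¹ θ) ∩
        sector s (angle φ s (a s θ))).Nonempty) →
      ∀ T : (s : dyadicScales R) → Fin (numSectors s) → Set E3,
      (∀ (s : dyadicScales R) τ, IsTiling (plank R s (angle φ s τ)) (T s τ)) →
      ∀ f : Fin (numSectors (√R)⁻¹) → E3 → ℂ,
      (∀ θ, Continuous (f θ)) → (∀ θ, Integrable (f θ)) →
      (∀ θ, ∀ ω ∉ dilatedSector A (√R)⁻¹ (angle φ (√R)⁻¹ θ), 𝓕 (f θ) ω = 0) →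
      ∫⁻ x, ‖sqSum Finset.univ f x‖ₑ ^ 2 ≤ C * tileSum R φ a T f := by
  obtain ⟨N, C, hC, hscale⟩ := exists_adapted_scale (K := 2 * A) (by linarith)
  obtain ⟨c, hc0, hc1, hcC⟩ : ∃ c : ℝ, 0 < c ∧ c ≤ 1 ∧ 12 * c * C ≤ 1 := by
    refine ⟨(1 + 12 * C)⁻¹, by positivity, inv_le_one_of_one_le₀ (by linarith), ?_⟩
    rw [show 12 * (1 + 12 * C)⁻¹ * C = 12 * C / (1 + 12 * C) by field_simp, div_le_one (by positivity)]
    linarith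
  refine ⟨N * (864 / c ^ 6).toNNReal, fun R hR φ a ha T hT f hfc hfi hfF => ?_⟩
  classical
  have hR0 : 0 < R := by linarith
  have hfFi (θ) : Integrable (𝓕 (f θ)) :=
    integrable_of_continuous_of_isBounded (continuous_fourier (hfi θ))
      (isBounded_dilatedSector _ _ _) (hfF θ)
  have hfb (θ) (x : E3) : ‖f θ x‖ ≤ ∫ ξ, ‖𝓕 (f θ) ξ‖ := by
    conv_lhs => rw [← (hfc θ).fourierInv_fourier_eq (hfi θ) (hfFi θ)]
    exact norm_fourierInv_le _ x
  have hsqi (θ) : Integrable fun x => ‖f θ x‖ ^ 2 := by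
    simp only [sq]
    exact (hfi θ).norm.bdd_mul (hfc θ).norm.aestronglyMeasurable
      (Filter.Eventually.of_forall fun x => by rw [norm_norm]; exact hfb θ x)
  obtain ⟨F, hF⟩ : ∃ F : Fin (numSectors (√R)⁻¹) → E3 → ℂ,
    ∀ θ, F θ = 𝓕 fun x => ((‖f θ x‖ ^ 2 : ℝ) : ℂ) := ⟨_, fun _ => rfl⟩
  have hFsupp (θ) (ω : E3) (hω : ω ∉ differenceBox (2 * A) R (angle φ (√R)⁻¹ θ)) : F θ ω = 0 := by
    rw [hF]
    exact fourier_norm_sq_eq_zero (hfc θ) (hfi θ) (hfFi θ) (hfF θ) fun ξ hξ η hη h =>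
      hω (h ▸ sub_mem_differenceBox hA hR hξ hη)
  have hgc (B : Finset (Fin (numSectors (√R)⁻¹))) : Continuous (sqSum B f) :=
    continuous_finsetSum _ fun θ _ => (hfc θ).norm.pow 2
  have hgi (B : Finset (Fin (numSectors (√R)⁻¹))) : Integrable (sqSum B f) :=
    integrable_finsetSum _ fun θ _ => hsqi θ
  have hgb (B : Finset (Fin (numSectors (√R)⁻¹))) :
      BddAbove (Set.range fun x => ‖(sqSum B f x : ℂ)‖) := by
    refine ⟨∑ θ ∈ B, (∫ ξ, ‖𝓕 (f θ) ξ‖) ^ 2, ?_⟩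
    rintro _ ⟨x, rfl⟩
    simp only [Complex.norm_real]
    rw [Real.norm_of_nonneg (sqSum_nonneg B f x)]
    exact Finset.sum_le_sum fun θ _ => pow_le_pow_left₀ (norm_nonneg _) (hfb θ x) 2
  have hgF (B : Finset (Fin (numSectors (√R)⁻¹))) (ω : E3) :
      𝓕 (fun x => (sqSum B f x : ℂ)) ω = ∑ θ ∈ B, F θ ω := by
    simp only [hF, Real.fourier_eq]
    rw [← integral_finsetSum]
    · congr 1
      ext x
      rw [← Finset.smul_sum, sqSum, Complex.ofReal_sum]
    · exact fun θ _ => (Real.fourierIntegral_convergent_iff ω).2 (hsqi θ).ofReal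
  obtain ⟨S, hS⟩ : ∃ S : Set E3, S = ⋃ θ, differenceBox (2 * A) R (angle φ (√R)⁻¹ θ) := ⟨_, rfl⟩
  have hSb : Bornology.IsBounded S :=
    hS ▸ Bornology.isBounded_iUnion.2 fun θ => isBounded_differenceBox _ _ _
  have hgS (B : Finset (Fin (numSectors (√R)⁻¹))) (ω : E3) (hω : ω ∉ S) :
      𝓕 (fun x => (sqSum B f x : ℂ)) ω = 0 := by
    rw [hgF]
    exact Finset.sum_eq_zero fun θ _ => hFsupp θ ω fun h => hω (hS ▸ Set.mem_iUnion.2 ⟨θ, h⟩)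
  obtain ⟨B, hB⟩ : ∃ B : (s : dyadicScales R) → Fin (numSectors s) →
      Finset (Fin (numSectors (√R)⁻¹)), ∀ s τ, B s τ = Finset.univ.filter fun θ => a s θ = τ :=
    ⟨_, fun _ _ => rfl⟩
  have hpt (ω : E3) : ‖𝓕 (fun x => (sqSum Finset.univ f x : ℂ)) ω‖ₑ ^ 2 ≤
      N * ∑' s : dyadicScales R, ∑ τ : Fin (numSectors s),
        (dualPlank C R s (angle φ s τ)).indicator
          (fun ω => ‖𝓕 (fun x => (sqSum (B s τ) f x : ℂ)) ω‖ₑ ^ 2) ω := by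
    obtain ⟨s, hs1, hs2⟩ := hscale R hR φ a ha ω
    have hbox (θ) (hθ : F θ ω ≠ 0) : ω ∈ differenceBox (2 * A) R (angle φ (√R)⁻¹ θ) := by
      by_contra h
      exact hθ (hFsupp θ ω h)
    have key := enorm_sum_sq_le_of_fibers (a s) (fun θ => F θ ω)
      (D := fun τ => dualPlank C R s (angle φ s τ)) (fun θ hθ => hs1 θ (hbox θ hθ))
      (fun S' hS' => hs2 S' fun θ hθ => hbox θ (hS' θ hθ))
    rw [hgF]
    -- The adapted scale depends on `ω`; bounding its term by the sum over all scales gives a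
    -- majorant that can be integrated in `ω`.
    refine key.trans (mul_le_mul_right (le_trans (le_of_eq ?_) (ENNReal.le_tsum s)) _)
    refine Finset.sum_congr rfl fun τ _ => ?_
    by_cases hω : ω ∈ dualPlank C R s (angle φ s τ)
    · rw [Set.indicator_of_mem hω, Set.indicator_of_mem hω, hgF, hB]
    · rw [Set.indicator_of_notMem hω, Set.indicator_of_notMem hω]
  have hcount := countable_dyadicScales R
  have hmeas (s : dyadicScales R) (τ : Fin (numSectors s)) : Measurable
      ((dualPlank C R s (angle φ s τ)).indicator
          (fun ω => ‖𝓕 (fun x => (sqSum (B s τ) f x : ℂ)) ω‖ₑ ^ 2)) :=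
    ((continuous_fourier (hgi _).ofReal).enorm.measurable.pow_const 2).indicator
      (isClosed_dualPlank _ _ _ _).measurableSet
  calc ∫⁻ x, ‖sqSum Finset.univ f x‖ₑ ^ 2
      = ∫⁻ x, ‖(sqSum Finset.univ f x : ℂ)‖ₑ ^ 2 := by
        refine lintegral_congr fun x => ?_
        rw [← ofReal_norm, ← ofReal_norm, Complex.norm_real]
    _ = ∫⁻ ω, ‖𝓕 (fun x => (sqSum Finset.univ f x : ℂ)) ω‖ₑ ^ 2 :=
        (lintegral_enorm_sq_fourier (Complex.continuous_ofReal.comp (hgc _)) (hgi _).ofReal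
          (integrable_of_continuous_of_isBounded (continuous_fourier (hgi _).ofReal) hSb
            (hgS _))).symm
    _ ≤ ∫⁻ ω, N * ∑' s : dyadicScales R, ∑ τ : Fin (numSectors s),
        (dualPlank C R s (angle φ s τ)).indicator
          (fun ω => ‖𝓕 (fun x => (sqSum (B s τ) f x : ℂ)) ω‖ₑ ^ 2) ω := lintegral_mono hpt
    _ = N * ∑' s : dyadicScales R, ∑ τ : Fin (numSectors s),
        ∫⁻ ω, (dualPlank C R s (angle φ s τ)).indicator
          (fun ω => ‖𝓕 (fun x => (sqSum (B s τ) f x : ℂ)) ω‖ₑ ^ 2) ω := by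
        rw [lintegral_const_mul' _ _ (by simp), lintegral_tsum fun s =>
          (Finset.measurable_sum _ fun τ _ => hmeas s τ).aemeasurable]
        congr 1
        exact tsum_congr fun s => lintegral_finsetSum _ fun τ _ => hmeas s τ
    _ ≤ N * ∑' s : dyadicScales R, ∑ τ : Fin (numSectors s), ENNReal.ofReal (864 / c ^ 6) *
          ∑' v : T s τ, (volume ((v : E3) +ᵥ plank R s (angle φ s τ)))⁻¹ *
          (∫⁻ x in (v : E3) +ᵥ plank R s (angle φ s τ), ‖sqSum (B s τ) f x‖ₑ) ^ 2 := by
        gcongr with s τ _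
        exact setLIntegral_fourier_dualPlank_le hR0 (pos_of_mem_dyadicScales hR s.2) hc0 hc1 hcC
          (hT s τ) (hgc _) (hgi _) (hgb _) hSb (hgS _)
    _ = _ := by
        simp only [← Finset.mul_sum]
        rw [ENNReal.tsum_mul_left, ← mul_assoc, tileSum]
        simp only [ENNReal.coe_mul, ENNReal.coe_natCast, hB]
        rfl

/-! ### Removal of continuity and integrability -/

/-- The estimate for integrable functions with Fourier support in the dilated sectors. -/
theorem exists_lintegral_sqSum_le_tileSum_of_integrable {A : ℝ} (hA : 1 ≤ A) :
    ∃ C : ℝ≥0, ∀ R : ℝ, 1 ≤ R → ∀ φ : ℝ → ℝ,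
      ∀ a : (s : dyadicScales R) → Fin (numSectors (√R)⁻¹) → Fin (numSectors s),
      (∀ (s : dyadicScales R) θ, (sector (√R)⁻¹ (angle φ (√R)⁻¹ θ) ∩
        sector s (angle φ s (a s θ))).Nonempty) →
      ∀ T : (s : dyadicScales R) → Fin (numSectors s) → Set E3,
      (∀ (s : dyadicScales R) τ, IsTiling (plank R s (angle φ s τ)) (T s τ)) →
      ∀ f : Fin (numSectors (√R)⁻¹) → E3 → ℂ, (∀ θ, Integrable (f θ)) →
      (∀ θ, ∀ ω ∉ dilatedSector A (√R)⁻¹ (angle φ (√R)⁻¹ θ), 𝓕 (f θ) ω = 0) →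
      ∫⁻ x, ‖sqSum Finset.univ f x‖ₑ ^ 2 ≤ C * tileSum R φ a T f := by
  obtain ⟨C, hC⟩ := exists_lintegral_sqSum_le_tileSum_of_continuous hA
  refine ⟨C, fun R hR φ a ha T hT f hfi hfF => ?_⟩
  have hfFi (θ) : Integrable (𝓕 (f θ)) :=
    integrable_of_continuous_of_isBounded (continuous_fourier (hfi θ))
      (isBounded_dilatedSector _ _ _) (hfF θ)
  -- The continuous representatives: they change neither side of the estimate nor the transforms.
  set f' : Fin (numSectors (√R)⁻¹) → E3 → ℂ := fun θ => 𝓕⁻ (𝓕 (f θ)) with hf'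
  have hae (θ) : f θ =ᵐ[volume] f' θ := ae_eq_fourierInv_fourier (hfi θ) (hfFi θ)
  have hsq (B : Finset (Fin (numSectors (√R)⁻¹))) : sqSum B f =ᵐ[volume] sqSum B f' := by
    filter_upwards [ae_all_iff.2 hae] with x hx
    simp only [sqSum, hx]
  have h := hC R hR φ a ha T hT f' (fun θ => continuous_fourierInv (hfFi θ))
    (fun θ => (hfi θ).congr (hae θ)) fun θ ω hω => by
      rw [← Real.fourier_congr_ae (hae θ), hfF θ ω hω]
  have e1 : ∫⁻ x, ‖sqSum Finset.univ f x‖ₑ ^ 2 = ∫⁻ x, ‖sqSum Finset.univ f' x‖ₑ ^ 2 :=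
    lintegral_congr_ae (by filter_upwards [hsq Finset.univ] with x hx; rw [hx])
  have e2 : tileSum R φ a T f = tileSum R φ a T f' := by
    unfold tileSum
    refine tsum_congr fun s => Finset.sum_congr rfl fun τ _ => tsum_congr fun v => ?_
    congr 2
    exact lintegral_congr_ae (ae_restrict_of_ae (by
      filter_upwards [hsq (Finset.univ.filter fun θ => a s θ = τ)] with x hx; rw [hx]))
  rwa [e1, e2]

theorem abs_inner_dir_le (α : ℝ) (x : E3) : |inner ℝ (coreDir α) x| ≤ 2 * ‖x‖ ∧
    |inner ℝ (normalDir α) x| ≤ 2 * ‖x‖ ∧ |inner ℝ (tangentDir α) x| ≤ 2 * ‖x‖ := by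
  have h := sq_norm_eq α x
  have h1 := sq_nonneg (inner ℝ (coreDir α) x)
  have h2 := sq_nonneg (inner ℝ (normalDir α) x)
  have h3 := sq_nonneg (inner ℝ (tangentDir α) x)
  refine ⟨?_, ?_, ?_⟩ <;> refine abs_le_of_sq_le_sq ?_ (by positivity) <;> rw [mul_pow] <;> linarith

/-- The doubled dilate of a sector contains a neighbourhood of the dilate. -/
theorem notMem_dilatedSector_of_dist_le {A r α : ℝ} (hA : 0 ≤ A) (hr0 : 0 ≤ r) (hr1 : r ≤ 1)
    {ω ξ : E3} (hω : ω ∉ dilatedSector (2 * A) r α) (h : dist ξ ω ≤ A * r ^ 2 / 4) :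
    ξ ∉ dilatedSector A r α := by
  rintro ⟨h1, h2, h3⟩
  refine hω ?_
  obtain ⟨g1, g2, g3⟩ := abs_inner_dir_le α (ξ - ω)
  rw [dist_eq_norm] at h
  rw [inner_sub_right] at g1 g2 g3
  have hr2 : r ^ 2 ≤ r := by nlinarith
  have i1 : A * r ^ 2 ≤ A * r := by gcongr
  have i2 : A * r ≤ A * 1 := by gcongr
  have i3 : 0 ≤ A * r ^ 2 := by positivity
  rw [abs_le] at h1 h2 h3 g1 g2 g3
  refine ⟨?_, ?_, ?_⟩ <;> rw [abs_le] <;> constructor <;> linarith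

/-- The Fourier transform of the normalized bump function `b`. -/
def bumpMultiplier (b : ContDiffBump (0 : E3)) : E3 → ℂ :=
  𝓕 fun ξ => (b.normed volume ξ : ℂ)

theorem norm_bumpMultiplier_le (b : ContDiffBump (0 : E3)) (x : E3) : ‖bumpMultiplier b x‖ ≤ 1 := by
  refine (norm_fourier_le _ x).trans (le_of_eq ?_)
  simp only [Complex.norm_real, Real.norm_of_nonneg (b.nonneg_normed _)]
  exact b.integral_normed

/-- The bump function translated to `ω`, as a Schwartz function. -/
def translatedBump (b : ContDiffBump (0 : E3)) (ω : E3) : 𝓢(E3, ℂ) :=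
  (show HasCompactSupport fun ξ : E3 => (b.normed volume (ξ - ω) : ℂ) from
    HasCompactSupport.of_support_subset_isCompact (isCompact_closedBall ω b.rOut) fun ξ hξ => by
      have h : ξ - ω ∈ Function.support (b.normed volume) := fun h => hξ (by simp [h])
      rw [b.support_normed_eq, mem_ball_zero_iff] at h
      rw [Metric.mem_closedBall, dist_eq_norm]
      exact h.le).toSchwartzMap
    (Complex.ofRealCLM.contDiff.comp (b.contDiff_normed.comp (contDiff_id.sub contDiff_const)))

theorem translatedBump_apply (b : ContDiffBump (0 : E3)) (ω ξ : E3) :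
    translatedBump b ω ξ = (b.normed volume (ξ - ω) : ℂ) := rfl

theorem tsupport_translatedBump_subset (b : ContDiffBump (0 : E3)) (ω : E3) :
    tsupport (translatedBump b ω) ⊆ Metric.closedBall ω b.rOut := by
  refine closure_minimal (fun ξ hξ => ?_) Metric.isClosed_closedBall
  have h : ξ - ω ∈ Function.support (b.normed volume) := fun h => hξ (by
    rw [translatedBump_apply, h, Complex.ofReal_zero])
  rw [b.support_normed_eq, mem_ball_zero_iff] at h
  rw [Metric.mem_closedBall, dist_eq_norm]
  exact h.le

/-- Translation becomes modulation, so pairing the transform of `f` with the bump at `ω` evaluates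
the transform of `f` times the multiplier at `ω`. -/
theorem fourier_translatedBump (b : ContDiffBump (0 : E3)) (ω x : E3) :
    𝓕 (translatedBump b ω) x = (Real.fourierChar (-inner ℝ x ω) : ℂ) * bumpMultiplier b x := by
  rw [SchwartzMap.fourier_coe, bumpMultiplier, Real.fourier_eq, Real.fourier_eq,
    ← integral_const_mul]
  rw [← integral_add_right_eq_self _ ω]
  congr 1
  ext ξ
  rw [translatedBump_apply, Circle.smul_def, Circle.smul_def, smul_eq_mul, smul_eq_mul, ← mul_assoc,
    ← Circle.coe_mul, ← AddChar.map_add_eq_mul, inner_add_left,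
    real_inner_comm x ω, add_sub_cancel_right, neg_add_rev]

/-- The normalized bumps are an approximate identity, and the character `ξ ↦ e(-ξ · x)` equals `1`
at `ξ = 0`. -/
theorem tendsto_bumpMultiplier {b : ℕ → ContDiffBump (0 : E3)}
    (hb : Filter.Tendsto (fun n => (b n).rOut) Filter.atTop (nhds 0)) (x : E3) :
    Filter.Tendsto (fun n => bumpMultiplier (b n) x) Filter.atTop (nhds 1) := by
  have h := ContDiffBump.convolution_tendsto_right_of_continuous (μ := volume) hb
    (g := fun ξ : E3 => (Real.fourierChar (inner ℝ ξ x) : ℂ)) (by fun_prop) 0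
  have e : ((Real.fourierChar (inner ℝ (0 : E3) x) : Circle) : ℂ) = 1 := by simp
  rw [e] at h
  refine h.congr fun n => ?_
  rw [bumpMultiplier, Real.fourier_eq, convolution_def]
  congr 1
  ext ξ
  rw [zero_sub, inner_neg_left, Circle.smul_def, smul_eq_mul, mul_comm]
  simp

/-- Multiplication by a bump multiplier makes a function integrable and spreads the Fourier support
by at most the radius of the bump. -/
theorem HasFourierSupportIn.mul_bumpMultiplier {f : E3 → ℂ} {K : Set E3}
    (hf : HasFourierSupportIn f K) (b : ContDiffBump (0 : E3)) :
    Integrable (fun x => bumpMultiplier b x * f x) ∧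
      ∀ ω, (∀ ξ, dist ξ ω ≤ b.rOut → ξ ∉ K) → 𝓕 (fun x => bumpMultiplier b x * f x) ω = 0 := by
  obtain ⟨u, hu, hv⟩ := hf
  constructor
  · have h := (hu (𝓕 (translatedBump b 0))).1
    refine h.congr (Filter.Eventually.of_forall fun x => ?_)
    simp [fourier_translatedBump]
  · intro ω hω
    have h := hv (translatedBump b ω) fun ξ hξ => hω ξ (tsupport_translatedBump_subset b ω hξ)
    rw [TemperedDistribution.fourier_apply, (hu _).2] at h
    rw [Real.fourier_eq, ← h]
    congr 1
    ext x
    rw [fourier_translatedBump, Circle.smul_def, smul_eq_mul, smul_eq_mul, mul_assoc]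

theorem sqSum_le_sqSum {ι : Type} (B : Finset ι) {f g : ι → E3 → ℂ} {x : E3}
    (h : ∀ θ, ‖f θ x‖ ≤ ‖g θ x‖) : sqSum B f x ≤ sqSum B g x :=
  Finset.sum_le_sum fun θ _ => pow_le_pow_left₀ (norm_nonneg _) (h θ) 2

theorem tileSum_mono {R : ℝ} (φ : ℝ → ℝ)
    (a : (s : dyadicScales R) → Fin (numSectors (√R)⁻¹) → Fin (numSectors s))
    (T : (s : dyadicScales R) → Fin (numSectors s) → Set E3)
    {f g : Fin (numSectors (√R)⁻¹) → E3 → ℂ} (h : ∀ θ x, ‖f θ x‖ ≤ ‖g θ x‖) :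
    tileSum R φ a T f ≤ tileSum R φ a T g := by
  unfold tileSum
  gcongr with s τ _ v x
  rw [← ofReal_norm, ← ofReal_norm, Real.norm_of_nonneg (sqSum_nonneg _ _ _),
    Real.norm_of_nonneg (sqSum_nonneg _ _ _)]
  exact ENNReal.ofReal_le_ofReal (sqSum_le_sqSum _ fun θ => h θ x)

/-- The estimate for functions defining tempered distributions with Fourier support in the dilated
sectors. -/
theorem exists_lintegral_sqSum_le_tileSum {A : ℝ} (hA : 1 ≤ A) :
    ∃ C : ℝ≥0, ∀ R : ℝ, 1 ≤ R → ∀ φ : ℝ → ℝ,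
      ∀ a : (s : dyadicScales R) → Fin (numSectors (√R)⁻¹) → Fin (numSectors s),
      (∀ (s : dyadicScales R) θ, (sector (√R)⁻¹ (angle φ (√R)⁻¹ θ) ∩
        sector s (angle φ s (a s θ))).Nonempty) →
      ∀ T : (s : dyadicScales R) → Fin (numSectors s) → Set E3,
      (∀ (s : dyadicScales R) τ, IsTiling (plank R s (angle φ s τ)) (T s τ)) →
      ∀ f : Fin (numSectors (√R)⁻¹) → E3 → ℂ,
      (∀ θ, HasFourierSupportIn (f θ) (dilatedSector A (√R)⁻¹ (angle φ (√R)⁻¹ θ))) →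
      ∫⁻ x, ‖sqSum Finset.univ f x‖ₑ ^ 2 ≤ C * tileSum R φ a T f := by
  -- The doubled dilate leaves room for the spreading of the Fourier support by the bumps.
  obtain ⟨C, hC⟩ := exists_lintegral_sqSum_le_tileSum_of_integrable (A := 2 * A) (by linarith)
  refine ⟨C, fun R hR φ a ha T hT f hf => ?_⟩
  have hr0 : 0 < (√R)⁻¹ := inv_pos.2 (Real.sqrt_pos.2 (by linarith))
  have hr1 : (√R)⁻¹ ≤ 1 := inv_le_one_of_one_le₀ (Real.one_le_sqrt.2 hR)
  -- A shift by `ε` changes each frame component by at most `2 ε = A r² / 2`, with `r = R^{-1/2}`;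
  -- this fits in the gaps `A / 2`, `A r²` and `A r` between the dilates.
  obtain ⟨ε, hε0, hε⟩ : ∃ ε : ℝ, 0 < ε ∧ ε = A * (√R)⁻¹ ^ 2 / 4 := ⟨_, by positivity, rfl⟩
  obtain ⟨b, hb⟩ : ∃ b : ℕ → ContDiffBump (0 : E3), ∀ n, (b n).rOut = ε * (1 / ((n : ℝ) + 1)) :=
    ⟨fun n => ⟨ε * (1 / ((n : ℝ) + 1)) / 2, ε * (1 / ((n : ℝ) + 1)), by positivity,
      half_lt_self (by positivity)⟩, fun _ => rfl⟩
  have hbε (n : ℕ) : (b n).rOut ≤ ε := by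
    rw [hb]
    refine mul_le_of_le_one_right hε0.le ?_
    rw [div_le_one (by positivity)]
    linarith [n.cast_nonneg (α := ℝ)]
  have hb0 : Filter.Tendsto (fun n => (b n).rOut) Filter.atTop (nhds 0) := by
    simp only [hb]
    simpa using tendsto_one_div_add_atTop_nhds_zero_nat.const_mul ε
  obtain ⟨F, hF⟩ : ∃ F : ℕ → Fin (numSectors (√R)⁻¹) → E3 → ℂ,
      ∀ n θ, F n θ = fun x => bumpMultiplier (b n) x * f θ x := ⟨_, fun _ _ => rfl⟩
  have hFi (n θ) : Integrable (F n θ) := hF n θ ▸ ((hf θ).mul_bumpMultiplier (b n)).1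
  have hle (n : ℕ) : ∫⁻ x, ‖sqSum Finset.univ (F n) x‖ₑ ^ 2 ≤ C * tileSum R φ a T f := by
    refine (hC R hR φ a ha T hT (F n) (hFi n) fun θ ω hω => ?_).trans ?_
    · rw [hF]
      refine ((hf θ).mul_bumpMultiplier (b n)).2 ω fun ξ hξ => ?_
      exact notMem_dilatedSector_of_dist_le (by linarith) hr0.le hr1 hω
        (hξ.trans ((hbε n).trans hε.le))
    · gcongr
      refine tileSum_mono φ a T fun θ x => ?_
      rw [hF, norm_mul]
      exact mul_le_of_le_one_left (norm_nonneg _) (norm_bumpMultiplier_le _ _)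
  have hlim (x : E3) : Filter.Tendsto (fun n => ‖sqSum Finset.univ (F n) x‖ₑ ^ 2) Filter.atTop
      (nhds (‖sqSum Finset.univ f x‖ₑ ^ 2)) := by
    refine ((ENNReal.continuous_pow 2).tendsto _).comp ((continuous_enorm.tendsto _).comp ?_)
    refine tendsto_finsetSum _ fun θ _ => ?_
    have h := (((tendsto_bumpMultiplier hb0 x).mul_const (f θ x)).norm).pow 2
    simpa [hF] using h
  have hmeas (n : ℕ) : AEMeasurable (fun x => ‖sqSum Finset.univ (F n) x‖ₑ ^ 2) :=
    (AEMeasurable.enorm (Finset.aemeasurable_fun_sum _ fun θ _ =>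
      (hFi n θ).aestronglyMeasurable.aemeasurable.norm.pow_const 2)).pow_const 2
  -- Fatou's lemma suffices, since the bound for the regularized functions is uniform in `n`.
  calc ∫⁻ x, ‖sqSum Finset.univ f x‖ₑ ^ 2
      = ∫⁻ x, Filter.liminf (fun n => ‖sqSum Finset.univ (F n) x‖ₑ ^ 2) Filter.atTop :=
        lintegral_congr fun x => (hlim x).liminf_eq.symm
    _ ≤ Filter.liminf (fun n => ∫⁻ x, ‖sqSum Finset.univ (F n) x‖ₑ ^ 2) Filter.atTop :=
        lintegral_liminf_le' hmeas
    _ ≤ C * tileSum R φ a T f :=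
        Filter.liminf_le_of_le (by isBoundedDefault) fun y hy => by
          obtain ⟨n, hn⟩ := hy.exists
          exact hn.trans (hle n)

end ConeSquare

end

theorem lemma1p4 (A : ℝ) (hA : 1 ≤ A) :
    ∃ C : ℝ≥0, ∀ R : ℝ, 1 ≤ R →
      -- the position of the evenly spaced directions at each scale
      ∀ φ : ℝ → ℝ,
      -- `θ ∈ A(τ)` for `τ = a s θ`: a partition of the sectors `θ`, each meeting its `τ`
      ∀ a : (s : ConeSquare.dyadicScales R) → Fin (ConeSquare.numSectors (√R)⁻¹) →
        Fin (ConeSquare.numSectors s),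
      (∀ (s : ConeSquare.dyadicScales R) θ, (ConeSquare.sector (√R)⁻¹ (ConeSquare.angle φ (√R)⁻¹ θ) ∩
          ConeSquare.sector s (ConeSquare.angle φ s (a s θ))).Nonempty) →
      -- for each `τ`, a tiling of space by translates of `U_{τ,R}`
      ∀ T : (s : ConeSquare.dyadicScales R) → Fin (ConeSquare.numSectors s) →
        Set ConeSquare.E3,
      (∀ (s : ConeSquare.dyadicScales R) τ, ConeSquare.IsTiling
        (ConeSquare.plank R s (ConeSquare.angle φ s τ)) (T s τ)) →
      ∀ (f : ConeSquare.E3 → ℂ)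
        (fθ : Fin (ConeSquare.numSectors (√R)⁻¹) → ConeSquare.E3 → ℂ),
      ConeSquare.HasFourierSupportIn f (Metric.cthickening R⁻¹ ConeSquare.cone) →
      (∀ θ, ConeSquare.HasFourierSupportIn (fθ θ)
        (ConeSquare.dilatedSector A (√R)⁻¹ (ConeSquare.angle φ (√R)⁻¹ θ))) →
      (f =ᵐ[volume] fun x => ∑ θ, fθ θ x) →
      ∫⁻ x, ‖ConeSquare.sqSum Finset.univ fθ x‖ₑ ^ 2 ≤
        C * ∑' s : ConeSquare.dyadicScales R,
          ∑ τ : Fin (ConeSquare.numSectors s),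
            ∑' v : T s τ,
              (volume ((v : ConeSquare.E3) +ᵥ
                ConeSquare.plank R s (ConeSquare.angle φ s τ)))⁻¹ *
              eLpNorm (ConeSquare.squareFn (Finset.univ.filter fun θ => a s θ = τ) fθ
                ((v : ConeSquare.E3) +ᵥ ConeSquare.plank R s (ConeSquare.angle φ s τ)))
                2 volume ^ 4 := by
  obtain ⟨C, hC⟩ := ConeSquare.exists_lintegral_sqSum_le_tileSum hA
  refine ⟨C, fun R hR φ a ha T hT f fθ _ hfθ _ => ?_⟩
  simp only [ConeSquare.eLpNorm_squareFn_pow _ _ (ConeSquare.measurableSet_vadd_plank _ _ _ _)]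
  exact hC R hR φ a ha T hT fθ hfθ
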